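/- Let $S$ be a cancellative left amenable semigroup, i.e. a semigroup with left and right cancellation for which there is a finitely additive probability measure $\mu$ on all subsets of $S$ with $\mu(\{x\in S: sx\in A\})=\mu(A)$ for all $s\in S$ and $A\subseteq S$. A left Følner net of $S$ is a net $(F_i)_{i\in I}$ of non-empty finite subsets of $S$ with $\lim_i |sF_i\setminus F_i|/|F_i|=0$ for every $s\in S$. For a left action $\gamma$ of $S$ on a compact space $C$ by continuous maps, an open cover $\mathcal U$ of $C$ and a non-empty finite $F\subseteq S$, let $\mathcal U_{\gamma,F}$ be the open cover consisting of all the sets $\bigcap_{s\in F}\gamma(s)^{-1}(V_s)$ with $V_s\in\mathcal U$ for $s\in F$, and let $N(\mathcal V)$ denote the least size of a finite subcover of an open cover $\mathcal V$. Put $$H_{top}(\gamma,\mathcal U)=\lim_{i\in I}\frac{\log N(\mathcal U_{\gamma,F_i})}{|F_i|},\qquad h_{top}(\gamma)=\sup\{H_{top}(\gamma,\mathcal U):\mathcal U\text{ an open cover of }C\}\in[0,\infty],$$ where $(F_i)_{i\in I}$ is any left Følner net of $S$. Let $K$ be a totally disconnected compact abelian group, let $\gamma$ be a left action of $S$ on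 $K$ by continuous endomorphisms (that is, $\gamma(st)=\gamma(s)\circ\gamma(t)$ for all $s,t\in S$), and let $L$ be a closed subgroup of $K$ with $\gamma(s)(L)\subseteq L$ for every $s\in S$. Denote by $\gamma_L$ and $\gamma_{K/L}$ the actions of $S$ induced by $\gamma$ on $L$ and on $K/L$. Then the topological entropies of $\gamma$, $\gamma_L$ and $\gamma_{K/L}$ are well defined (left Følner nets of $S$ exist and, for every open cover, the above limit exists in $\mathbb R$ and does not depend on the choice of the left Følner net), and $$h_{top}(\gamma)=h_{top}(\gamma_L)+h_{top}(\gamma_{K/L}).$$ -/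

import Mathlib

open Filter Topology
open scoped ENNReal

noncomputable section

namespace SemigroupEntropy

/-- A semigroup `S` is left amenable if there is a finitely additive probability measure `μ`
on the family of all subsets of `S`, with values in `[0, 1]`, such that
`μ (L_s⁻¹ A) = μ A` for every `s` and every `A`, where `L_s x = s * x`. -/
def LeftAmenable (S : Type*) [Semigroup S] : Prop :=
  ∃ μ : Set S → ℝ,
    (∀ A, 0 ≤ μ A ∧ μ A ≤ 1) ∧
    μ Set.univ = 1 ∧
    (∀ A B, Disjoint A B → μ (A ∪ B) = μ A + μ B) ∧
    ∀ (s : S) (A : Set S), μ ((fun x => s * x) ⁻¹' A) = μ A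

open Classical in
/-- The ratio `|sF \ F| / |F|`. -/
def folnerRatio {S : Type*} [Semigroup S] (s : S) (F : Finset S) : ℝ :=
  ((F.image (fun x => s * x) \ F).card : ℝ) / (F.card : ℝ)

/-- The filter of left Følner sets of `S`: the coarsest filter on the finite subsets of `S` that
contains the set of all non-empty ones and along which `|sF \ F| / |F|` tends to `0` for every
`s`.  A net of non-empty finite sets is a left Følner net if and only if it tends to this filter
(see `tendsto_leftFolner_iff`), so a limit along this filter is the common limit along all left
Følner nets. -/
def leftFolner (S : Type*) [Semigroup S] : Filter (Finset S) :=
  𝓟 {F | F.Nonempty} ⊓ ⨅ s : S, comap (folnerRatio s) (𝓝 0)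

theorem tendsto_leftFolner_iff {S ι : Type*} [Semigroup S] {l : Filter ι} {F : ι → Finset S} :
    Tendsto F l (leftFolner S) ↔
      (∀ᶠ i in l, (F i).Nonempty) ∧ ∀ s : S, Tendsto (fun i => folnerRatio s (F i)) l (𝓝 0) := by
  simp [leftFolner, tendsto_inf, tendsto_iInf, tendsto_comap_iff, Function.comp_def]

/-- `𝒰` is an open cover of the space `C`. -/
def OpenCover {C : Type*} [TopologicalSpace C] (𝒰 : Set (Set C)) : Prop :=
  (∀ U ∈ 𝒰, IsOpen U) ∧ ⋃₀ 𝒰 = Set.univ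

/-- `N(𝒰)`: the least positive size of a finite subcover of `𝒰`. -/
def coverNumber {C : Type*} (𝒰 : Set (Set C)) : ℕ :=
  sInf {n : ℕ | 0 < n ∧ ∃ 𝒱 : Finset (Set C),
    (𝒱 : Set (Set C)) ⊆ 𝒰 ∧ ⋃₀ (𝒱 : Set (Set C)) = Set.univ ∧ 𝒱.card = n}

/-- The cover `𝒰_{γ,F} = ⋁_{s ∈ F} γ(s)⁻¹(𝒰)`: its members are the intersections
`⋂_{s ∈ F} γ(s)⁻¹(V_s)` with `V_s ∈ 𝒰` for every `s ∈ F`. -/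
def joinCover {S C : Type*} (γ : S → C → C) (𝒰 : Set (Set C)) (F : Finset S) : Set (Set C) :=
  {W | ∃ V : S → Set C, (∀ s ∈ F, V s ∈ 𝒰) ∧ W = ⋂ s ∈ F, γ s ⁻¹' V s}

/-- The quotient `log N(𝒰_{γ,F}) / |F|`. -/
def entropyRatio {S C : Type*} (γ : S → C → C) (𝒰 : Set (Set C)) (F : Finset S) : ℝ :=
  Real.log (coverNumber (joinCover γ 𝒰 F)) / (F.card : ℝ)

/-- `H_top(γ, 𝒰)`: the limit of `log N(𝒰_{γ,F}) / |F|` along the left Følner sets `F`. -/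
def coverEntropy {S C : Type*} [Semigroup S] (γ : S → C → C) (𝒰 : Set (Set C)) : ℝ :=
  limUnder (leftFolner S) (entropyRatio γ 𝒰)

/-- `h_top(γ)`: the supremum of `H_top(γ, 𝒰)` over all open covers `𝒰`. -/
def topEntropy {S C : Type*} [Semigroup S] [TopologicalSpace C] (γ : S → C → C) : ℝ≥0∞ :=
  ⨆ (𝒰 : Set (Set C)) (_ : OpenCover 𝒰), ENNReal.ofReal (coverEntropy γ 𝒰)

/-- All the limits in the definition of the topological entropy of `γ` exist: there are left
Følner nets and, for every open cover `𝒰`, the quotients `log N(𝒰_{γ,F}) / |F|` converge to the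
same real number `H_top(γ, 𝒰)` along each of them. -/
def TopEntropyWellDefined {S C : Type*} [Semigroup S] [TopologicalSpace C]
    (γ : S → C → C) : Prop :=
  (leftFolner S).NeBot ∧ ∀ 𝒰 : Set (Set C), OpenCover 𝒰 →
    Tendsto (entropyRatio γ 𝒰) (leftFolner S) (𝓝 (coverEntropy γ 𝒰))

/-- The subgroup `L` is invariant under the action `γ`. -/
def Invariant {S K : Type*} [Semigroup S] [AddCommGroup K] (γ : S →ₙ* AddMonoid.End K)
    (L : AddSubgroup K) : Prop :=
  ∀ s : S, ∀ x ∈ L, γ s x ∈ L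

/-- The action `γ_L` induced by `γ` on an invariant subgroup `L`. -/
def restrictAction {S K : Type*} [Semigroup S] [AddCommGroup K] (γ : S →ₙ* AddMonoid.End K)
    (L : AddSubgroup K) (hL : Invariant γ L) : S →ₙ* AddMonoid.End L where
  toFun s := ((γ s).comp L.subtype).codRestrict L fun x => hL s x x.2
  map_mul' s t := by
    ext x
    exact DFunLike.congr_fun (map_mul γ s t) (x : K)

/-- The action `γ_{K/L}` induced by `γ` on the quotient by an invariant subgroup `L`. -/
def quotientAction {S K : Type*} [Semigroup S] [AddCommGroup K] (γ : S →ₙ* AddMonoid.End K)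
    (L : AddSubgroup K) (hL : Invariant γ L) : S →ₙ* AddMonoid.End (K ⧸ L) where
  toFun s := QuotientAddGroup.map L L (γ s) fun x hx => hL s x hx
  map_mul' s t := by
    apply QuotientAddGroup.addMonoidHom_ext
    ext x
    exact congrArg (QuotientAddGroup.mk' L) (DFunLike.congr_fun (map_mul γ s t) x)

end SemigroupEntropy

end

namespace SemigroupEntropy

/-! For an open subgroup H of K write H_F = ⋂_{s ∈ F} γ(s)⁻¹(H). The cosets of H form an open cover
whose join over F is, up to the empty set, the partition into cosets of H_F, so its cover number is
the index [K : H_F] (`coverNumber_joinCover_cosetCover`). Since K is profinite, such covers are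
cofinal. The entropies of γ, γ_L and γ_{K/L} are therefore the suprema over H of a(H), b(H) and
c(H), the limits of log[K : H_F]/|F|, log[L : L ∩ H_F]/|F| and log[K : (H+L)_F]/|F|.

The inequality b(H) + c(H) ≤ a(H) follows from [K : H_F] = [L : L ∩ H_F]·[K : H_F + L] and H_F + L ⊆
(H+L)_F. As b and c grow when H shrinks, the two suprema can be taken simultaneously.

For the converse, quasi-tile F by translates Tc with c ∈ F, of finitely many shapes T satisfying
log[L : L ∩ H_T] < (b(H)+ε)|T|. Let N be the intersection of the H_T and W = (N+L)_F. Since c ∈ F,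
γ(c) maps W into N+L ⊆ H_T+L, and H_{Tc} = γ(c)⁻¹(H_T), so each tile contributes at most [L : L ∩
H_T] to [W : W ∩ H_F]; the few uncovered points contribute at most [K : H] each
(`log_index_joinSubgroup_le`). Hence a(H) ≤ c(N) + (b(H)+ε)/(1-ε) + ε log[K : H], and ε → 0. No
injectivity or surjectivity of the maps γ(s) is involved.

The same quasi-tilings give the Ornstein–Weiss lemma, hence existence of the limits. Følner sets
themselves come from the invariant mean by the arguments of Day and Namioka. -/

/-- `T` is non-empty and `|kT \ T| ≤ δ |T|` for every `k ∈ E`. -/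
def AlmostInvariant {S : Type*} [Semigroup S] (δ : ℝ) (E T : Finset S) : Prop :=
  T.Nonempty ∧ ∀ k ∈ E, folnerRatio k T ≤ δ

theorem eventually_almostInvariant {S : Type*} [Semigroup S] {δ : ℝ} (hδ : 0 < δ)
    (E : Finset S) : ∀ᶠ F in leftFolner S, AlmostInvariant δ E F := by
  have h := tendsto_leftFolner_iff.1 (tendsto_id (α := Finset S) (x := leftFolner S))
  have h2 : ∀ᶠ F in leftFolner S, ∀ k ∈ E, folnerRatio k F ≤ δ := by
    rw [Filter.eventually_all_finset]
    intro k _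
    exact (h.2 k).eventually (Iic_mem_nhds hδ)
  filter_upwards [h.1, h2] with F h1 h3
  exact ⟨h1, h3⟩

open Classical in
theorem AlmostInvariant.card_le {S : Type*} [Semigroup S] {δ : ℝ} {E T : Finset S}
    (h : AlmostInvariant δ E T) {k : S} (hk : k ∈ E) :
    ((T.image (fun x => k * x) \ T).card : ℝ) ≤ δ * T.card := by
  have h1 := h.2 k hk
  have h2 : (0 : ℝ) < T.card := by exact_mod_cast h.1.card_pos
  unfold folnerRatio at h1
  rwa [div_le_iff₀ h2] at h1

/-! ### Quasi-tilings by right translates -/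

open Classical in
/-- The translate `Tc` encoded by the pair `(T, c)`. -/
noncomputable def tile {S : Type*} [Semigroup S] (p : Finset S × S) : Finset S :=
  p.1.image (fun x => x * p.2)

open Classical in
/-- The union of the translates encoded by `D`. -/
noncomputable def tileUnion {S : Type*} [Semigroup S] (D : Finset (Finset S × S)) : Finset S :=
  D.biUnion tile

/-- A family of translates `Tc ⊆ F` with `c ∈ F` that overlap in a small proportion only. -/
structure IsQuasiTiling {S : Type*} [Semigroup S] (ε : ℝ) (F : Finset S)
    (D : Finset (Finset S × S)) : Prop where
  center_mem : ∀ p ∈ D, p.2 ∈ F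
  tile_subset : ∀ p ∈ D, tile p ⊆ F
  card_le : (1 - ε) * ∑ p ∈ D, (p.1.card : ℝ) ≤ (tileUnion D).card

theorem IsQuasiTiling.tileUnion_subset {S : Type*} [Semigroup S] {ε : ℝ} {F : Finset S}
    {D : Finset (Finset S × S)} (h : IsQuasiTiling ε F D) : tileUnion D ⊆ F := by
  intro x hx
  simp only [tileUnion, Finset.mem_biUnion] at hx
  obtain ⟨p, hp, hx⟩ := hx
  exact h.tile_subset p hp hx

theorem tileUnion_mono {S : Type*} [Semigroup S] {D D' : Finset (Finset S × S)} (h : D ⊆ D') :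
    tileUnion D ⊆ tileUnion D' := by
  classical
  exact Finset.biUnion_subset_biUnion_of_subset_left _ h

theorem IsQuasiTiling.sum_le {S : Type*} [Semigroup S] {ε : ℝ} (hε : ε ≤ 1 / 2)
    {F : Finset S} {D : Finset (Finset S × S)} (h : IsQuasiTiling ε F D) :
    ∑ p ∈ D, (p.1.card : ℝ) ≤ 2 * F.card := by
  have h1 := h.card_le
  have h2 : ((tileUnion D).card : ℝ) ≤ F.card := by
    exact_mod_cast Finset.card_le_card h.tileUnion_subset
  have h3 : 0 ≤ ∑ p ∈ D, (p.1.card : ℝ) := Finset.sum_nonneg fun _ _ => by positivity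
  nlinarith

/-! ### The Ornstein–Weiss quasi-tiling theorem -/

section Counting

variable {S : Type*} [Semigroup S] [IsCancelMul S]

theorem card_tile (p : Finset S × S) : (tile p).card = p.1.card := by
  classical
  exact Finset.card_image_of_injective _ (mul_left_injective p.2)

-- Left cancellation gives |kB| = |B|, hence |kB∖B| = |B∖kB|, and x ↦ kx embeds the points that
-- enter B into B∖kB.
open Classical in
theorem card_le_of_enter {k : S} {X B : Finset S} (h : ∀ x ∈ X, k * x ∈ B ∧ x ∉ B) :
    X.card ≤ (B.image (fun x => k * x) \ B).card := by
  have h1 : (B.image (fun x => k * x)).card = B.card :=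
    Finset.card_image_of_injective _ (mul_right_injective k)
  rw [Finset.card_sdiff_comm h1]
  rw [← Finset.card_image_of_injective X (mul_right_injective k)]
  apply Finset.card_le_card
  intro y hy
  simp only [Finset.mem_image] at hy
  obtain ⟨x, hx, rfl⟩ := hy
  simp only [Finset.mem_sdiff, Finset.mem_image, not_exists, not_and]
  refine ⟨(h x hx).1, fun z hz hzx => (h x hx).2 ?_⟩
  rwa [← mul_right_injective k hzx]

open Classical in
theorem card_le_of_leave {k : S} {X B : Finset S} (h : ∀ x ∈ X, x ∈ B ∧ k * x ∉ B) :
    X.card ≤ (B.image (fun x => k * x) \ B).card := by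
  rw [← Finset.card_image_of_injective X (mul_right_injective k)]
  apply Finset.card_le_card
  intro y hy
  simp only [Finset.mem_image] at hy
  obtain ⟨x, hx, rfl⟩ := hy
  exact Finset.mem_sdiff.2 ⟨Finset.mem_image_of_mem _ (h x hx).1, (h x hx).2⟩

-- Since k(tc) = (kt)c, the set k(Tc)∖Tc lies in (kT∖T)c: right translates inherit left almost
-- invariance from their shape.
open Classical in
theorem card_image_tile_sdiff_le (k : S) (p : Finset S × S) :
    ((tile p).image (fun x => k * x) \ tile p).card ≤
      (p.1.image (fun x => k * x) \ p.1).card := by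
  rw [← Finset.card_image_of_injective (p.1.image (fun x => k * x) \ p.1)
    (mul_left_injective p.2)]
  apply Finset.card_le_card
  intro y hy
  simp only [tile, Finset.mem_sdiff, Finset.mem_image, not_exists, not_and] at hy
  obtain ⟨⟨_, ⟨t, ht, rfl⟩, rfl⟩, hy⟩ := hy
  refine Finset.mem_image.2 ⟨k * t, Finset.mem_sdiff.2 ⟨Finset.mem_image_of_mem _ ht, ?_⟩,
    mul_assoc _ _ _⟩
  exact fun h => hy _ h (mul_assoc _ _ _)

-- Take a family of maximal size. A translate of T meeting the union in fewer than ε|T| points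
-- enlarges the union by more than (1-ε)|T|, so it could still be added.
open Classical in
theorem IsQuasiTiling.exists_extend {ε : ℝ} {F : Finset S} {D : Finset (Finset S × S)}
    (h : IsQuasiTiling ε F D) (hε : ε ≤ 1) (T : Finset S) :
    ∃ D', D ⊆ D' ∧ IsQuasiTiling ε F D' ∧ (∀ p ∈ D', p ∈ D ∨ p.1 = T) ∧
      ∀ c ∈ F, tile (T, c) ⊆ F → ε * T.card ≤ (tile (T, c) ∩ tileUnion D').card := by
  set 𝒞 := (D ∪ F.image (fun c => (T, c))).powerset.filter
    (fun D' => D ⊆ D' ∧ IsQuasiTiling ε F D') with h𝒞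
  have hne : 𝒞.Nonempty :=
    ⟨D, Finset.mem_filter.2 ⟨Finset.mem_powerset.2 Finset.subset_union_left, subset_rfl, h⟩⟩
  obtain ⟨D', hD', hmax⟩ := Finset.exists_max_image 𝒞 Finset.card hne
  obtain ⟨hsub, hDD', hq⟩ := Finset.mem_filter.1 hD'
  rw [Finset.mem_powerset] at hsub
  refine ⟨D', hDD', hq, fun p hp => ?_, fun c hc hcF => ?_⟩
  · rcases Finset.mem_union.1 (hsub hp) with h1 | h1
    · exact Or.inl h1
    · obtain ⟨c, -, rfl⟩ := Finset.mem_image.1 h1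
      exact Or.inr rfl
  · by_contra! hlt
    have hnot : (T, c) ∉ D' := by
      intro hmem
      have : tile (T, c) ∩ tileUnion D' = tile (T, c) :=
        Finset.inter_eq_left.2 (Finset.subset_biUnion_of_mem tile hmem)
      rw [this, card_tile] at hlt
      have : (0 : ℝ) ≤ T.card := by positivity
      simp only at hlt
      nlinarith
    have hU : tileUnion (insert (T, c) D') = tile (T, c) ∪ tileUnion D' :=
      Finset.biUnion_insert
    have hq' : IsQuasiTiling ε F (insert (T, c) D') := by
      refine ⟨?_, ?_, ?_⟩
      · intro p hp
        rcases Finset.mem_insert.1 hp with rfl | hp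
        exacts [hc, hq.center_mem p hp]
      · intro p hp
        rcases Finset.mem_insert.1 hp with rfl | hp
        exacts [hcF, hq.tile_subset p hp]
      · rw [Finset.sum_insert hnot, hU]
        have h1 := hq.card_le
        have h2 : ((tile (T, c) ∪ tileUnion D').card : ℝ) + (tile (T, c) ∩ tileUnion D').card =
            T.card + (tileUnion D').card := by
          have := Finset.card_union_add_card_inter (tile (T, c)) (tileUnion D')
          rw [card_tile] at this
          exact_mod_cast this
        simp only
        linarith
    have h1 := hmax (insert (T, c) D') (Finset.mem_filter.2 ⟨?_, ?_, hq'⟩)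
    · rw [Finset.card_insert_of_notMem hnot] at h1
      omega
    · rw [Finset.mem_powerset]
      exact Finset.insert_subset
        (Finset.mem_union_right _ (Finset.mem_image_of_mem _ hc)) hsub
    · exact hDD'.trans (Finset.subset_insert _ _)

-- Double count the pairs (c, k) with c ∈ F∖A, Tc ⊆ F, k ∈ T and kc ∈ A', where A and A' are the old
-- and the new union. Maximality gives at least ε|T| pairs for each c. For fixed k, either kc ∈
-- A'∖A, or c enters an old tile; the latter is rare because old tiles are almost invariant under T.
-- So A'∖A fills about the proportion ε of F∖A.
open Classical in
theorem IsQuasiTiling.exists_extend_card_le {ε δ : ℝ} (hε0 : 0 < ε) (hε : ε ≤ 1 / 2)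
    (hδ : 0 ≤ δ) {F T : Finset S} {D : Finset (Finset S × S)} (h : IsQuasiTiling ε F D)
    (hT : T.Nonempty) (hD : ∀ p ∈ D, AlmostInvariant δ T p.1)
    (hF : AlmostInvariant (δ / T.card) T F) :
    ∃ D', IsQuasiTiling ε F D' ∧ (∀ p ∈ D', p ∈ D ∨ p.1 = T) ∧
      ((F \ tileUnion D').card : ℝ) ≤ (1 - ε) * (F \ tileUnion D).card + 3 * δ * F.card := by
  obtain ⟨D', hDD', hq, hmem, hc⟩ := h.exists_extend (by linarith) T
  refine ⟨D', hq, hmem, ?_⟩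
  have hTpos : (0 : ℝ) < T.card := by exact_mod_cast hT.card_pos
  set A := tileUnion D
  set A' := tileUnion D'
  have hAA' : A ⊆ A' := tileUnion_mono hDD'
  set G := (F \ A).filter (fun c => tile (T, c) ⊆ F) with hG
  -- few elements of `F` are not admissible
  have hG1 : ((F \ A).card : ℝ) - δ * F.card ≤ G.card := by
    have h1 : (F \ A).filter (fun c => ¬ tile (T, c) ⊆ F) ⊆
        T.biUnion fun k => F.filter (fun c => k * c ∉ F) := by
      intro c hcm
      simp only [Finset.mem_filter, Finset.mem_sdiff, tile, Finset.image_subset_iff,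
        not_forall] at hcm
      obtain ⟨⟨hcF, -⟩, k, hk, hkc⟩ := hcm
      exact Finset.mem_biUnion.2 ⟨k, hk, Finset.mem_filter.2 ⟨hcF, hkc⟩⟩
    have h2 : (((F \ A).filter (fun c => ¬ tile (T, c) ⊆ F)).card : ℝ) ≤ δ * F.card := by
      calc (((F \ A).filter (fun c => ¬ tile (T, c) ⊆ F)).card : ℝ)
          ≤ ∑ k ∈ T, ((F.filter (fun c => k * c ∉ F)).card : ℝ) := by
            exact_mod_cast (Finset.card_le_card h1).trans Finset.card_biUnion_le
        _ ≤ ∑ k ∈ T, δ / T.card * F.card := by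
            refine Finset.sum_le_sum fun k hk => le_trans ?_ (hF.card_le hk)
            exact_mod_cast card_le_of_leave fun x hx => Finset.mem_filter.1 hx
        _ = δ * F.card := by
            rw [Finset.sum_const, nsmul_eq_mul]
            field_simp
    have h3 := Finset.card_filter_add_card_filter_not (s := F \ A) (fun c => tile (T, c) ⊆ F)
    have h4 : (G.card : ℝ) + ((F \ A).filter (fun c => ¬ tile (T, c) ⊆ F)).card =
        (F \ A).card := by exact_mod_cast h3
    linarith
  have hk : ∀ k ∈ T, ((G.filter (fun c => k * c ∈ A')).card : ℝ) ≤
      (A' \ A).card + 2 * δ * F.card := by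
    intro k hk
    have h1 : G.filter (fun c => k * c ∈ A') ⊆ G.filter (fun c => k * c ∈ A' \ A) ∪
        D.biUnion fun p => G.filter (fun c => k * c ∈ tile p) := by
      intro c hcm
      obtain ⟨hcG, hcA'⟩ := Finset.mem_filter.1 hcm
      by_cases hcA : k * c ∈ A
      · obtain ⟨p, hp, hkp⟩ := Finset.mem_biUnion.1 hcA
        exact Finset.mem_union_right _
          (Finset.mem_biUnion.2 ⟨p, hp, Finset.mem_filter.2 ⟨hcG, hkp⟩⟩)
      · exact Finset.mem_union_left _
          (Finset.mem_filter.2 ⟨hcG, Finset.mem_sdiff.2 ⟨hcA', hcA⟩⟩)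
    have h2 : (G.filter (fun c => k * c ∈ A' \ A)).card ≤ (A' \ A).card := by
      refine Finset.card_le_card_of_injOn (fun c => k * c) ?_ (mul_right_injective k).injOn
      intro c hcm
      exact (Finset.mem_filter.1 hcm).2
    have h3 : ∀ p ∈ D, ((G.filter (fun c => k * c ∈ tile p)).card : ℝ) ≤ δ * p.1.card := by
      intro p hp
      refine le_trans ?_ ((hD p hp).card_le hk)
      have h4 : (G.filter (fun c => k * c ∈ tile p)).card ≤
          ((tile p).image (fun x => k * x) \ tile p).card := by
        apply card_le_of_enter
        intro x hx
        obtain ⟨hxG, hxp⟩ := Finset.mem_filter.1 hx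
        refine ⟨hxp, fun hx' => ?_⟩
        exact (Finset.mem_sdiff.1 (Finset.mem_filter.1 hxG).1).2
          (Finset.mem_biUnion.2 ⟨p, hp, hx'⟩)
      exact_mod_cast h4.trans (card_image_tile_sdiff_le k p)
    calc ((G.filter (fun c => k * c ∈ A')).card : ℝ)
        ≤ (G.filter (fun c => k * c ∈ A' \ A)).card +
          ∑ p ∈ D, ((G.filter (fun c => k * c ∈ tile p)).card : ℝ) := by
          exact_mod_cast (Finset.card_le_card h1).trans ((Finset.card_union_le _ _).trans
            (Nat.add_le_add_left Finset.card_biUnion_le _))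
      _ ≤ (A' \ A).card + ∑ p ∈ D, δ * (p.1.card : ℝ) :=
          add_le_add (by exact_mod_cast h2) (Finset.sum_le_sum h3)
      _ ≤ (A' \ A).card + 2 * δ * F.card := by
          rw [← Finset.mul_sum]
          have := mul_le_mul_of_nonneg_left (h.sum_le hε) hδ
          linarith
  have hsum : (G.card : ℝ) * (ε * T.card) ≤ T.card * ((A' \ A).card + 2 * δ * F.card) := by
    calc (G.card : ℝ) * (ε * T.card) = ∑ c ∈ G, ε * T.card := by
          rw [Finset.sum_const, nsmul_eq_mul]
      _ ≤ ∑ c ∈ G, ((T.filter (fun k => k * c ∈ A')).card : ℝ) := by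
          refine Finset.sum_le_sum fun c hcG => ?_
          obtain ⟨hcF, hct⟩ := Finset.mem_filter.1 hcG
          refine (hc c (Finset.mem_sdiff.1 hcF).1 hct).trans ?_
          have : tile (T, c) ∩ A' ⊆ (T.filter (fun k => k * c ∈ A')).image (fun k => k * c) := by
            intro y hy
            simp only [tile, Finset.mem_inter, Finset.mem_image] at hy
            obtain ⟨⟨k, hkT, rfl⟩, hy⟩ := hy
            exact Finset.mem_image.2 ⟨k, Finset.mem_filter.2 ⟨hkT, hy⟩, rfl⟩
          exact_mod_cast (Finset.card_le_card this).trans Finset.card_image_le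
      _ = ∑ k ∈ T, ((G.filter (fun c => k * c ∈ A')).card : ℝ) := by
          have := Finset.sum_card_bipartiteAbove_eq_sum_card_bipartiteBelow
            (s := G) (t := T) (fun c k => k * c ∈ A')
          simp only [Finset.bipartiteAbove, Finset.bipartiteBelow] at this
          exact_mod_cast this
      _ ≤ ∑ k ∈ T, (((A' \ A).card : ℝ) + 2 * δ * F.card) := Finset.sum_le_sum hk
      _ = _ := by rw [Finset.sum_const, nsmul_eq_mul]
  have hsum' : ε * G.card ≤ (A' \ A).card + 2 * δ * F.card := by
    refine le_of_mul_le_mul_left ?_ hTpos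
    linarith
  have hcard : ((F \ A').card : ℝ) + (A' \ A).card = (F \ A).card := by
    have h1 : F \ A = (F \ A') ∪ (A' \ A) := by
      ext x
      have h2 := @hAA' x
      have h3 : x ∈ A' → x ∈ F := fun h => hq.tileUnion_subset h
      simp only [Finset.mem_sdiff, Finset.mem_union]
      tauto
    have h2 : Disjoint (F \ A') (A' \ A) :=
      Finset.disjoint_left.2 fun x hx hx' =>
        (Finset.mem_sdiff.1 hx).2 (Finset.mem_sdiff.1 hx').1
    rw [h1, Finset.card_union_of_disjoint h2]
    push_cast
    rfl
  have h5 : ε * (((F \ A).card : ℝ) - δ * F.card) ≤ ε * G.card :=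
    mul_le_mul_of_nonneg_left hG1 hε0.le
  -- Of the error 3δ|F|, one part comes from the centres c with Tc ⊄ F, the other two from entering
  -- old tiles.
  have h6 : ε * (δ * F.card) ≤ 1 * (δ * F.card) :=
    mul_le_mul_of_nonneg_right (by linarith) (by positivity)
  linarith

-- Each further shape multiplies the uncovered proportion by 1-ε, up to an error 3δ.
open Classical in
theorem exists_quasiTiling_pow {ε δ : ℝ} (hε0 : 0 < ε) (hε : ε ≤ 1 / 2) (hδ : 0 < δ)
    {P : Finset S → Prop} (hP : ∃ᶠ F in leftFolner S, P F) (n : ℕ) (E : Finset S) :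
    ∃ 𝒯 : Finset (Finset S), (∀ T ∈ 𝒯, P T ∧ AlmostInvariant δ E T) ∧
      ∀ᶠ F in leftFolner S, ∃ D, IsQuasiTiling ε F D ∧ (∀ p ∈ D, p.1 ∈ 𝒯) ∧
        ((F \ tileUnion D).card : ℝ) ≤ ((1 - ε) ^ n + 3 * δ / ε) * F.card := by
  induction n generalizing E with
  | zero =>
    refine ⟨∅, by simp, Eventually.of_forall fun F => ⟨∅, ⟨by simp, by simp, by simp⟩,
      by simp, ?_⟩⟩
    have h1 : ((F \ tileUnion ∅).card : ℝ) ≤ F.card := by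
      exact_mod_cast Finset.card_le_card Finset.sdiff_subset
    have h2 : 0 ≤ 3 * δ / ε * F.card := by positivity
    rw [pow_zero]
    linarith
  | succ n ih =>
    obtain ⟨K, hKP, hKE⟩ := (hP.and_eventually (eventually_almostInvariant hδ E)).exists
    -- The last shape to be placed is chosen first, so that all shapes placed before it can be
    -- required to be almost invariant under it.
    obtain ⟨𝒯, h𝒯, hev⟩ := ih (E ∪ K)
    have hK : (0 : ℝ) < K.card := by exact_mod_cast hKE.1.card_pos
    refine ⟨insert K 𝒯, ?_, ?_⟩
    · intro T hT
      rcases Finset.mem_insert.1 hT with rfl | hT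
      · exact ⟨hKP, hKE⟩
      · exact ⟨(h𝒯 T hT).1, (h𝒯 T hT).2.1,
          fun k hk => (h𝒯 T hT).2.2 k (Finset.mem_union_left _ hk)⟩
    · filter_upwards [hev, eventually_almostInvariant (div_pos hδ hK) K] with F hF hFK
      obtain ⟨D, hq, hD, hcard⟩ := hF
      obtain ⟨D', hq', hD', hcard'⟩ := hq.exists_extend_card_le hε0 hε hδ.le hKE.1
        (fun p hp => ⟨(h𝒯 _ (hD p hp)).2.1,
          fun k hk => (h𝒯 _ (hD p hp)).2.2 k (Finset.mem_union_right _ hk)⟩) hFK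
      refine ⟨D', hq', fun p hp => ?_, hcard'.trans ?_⟩
      · rcases hD' p hp with h | h
        · exact Finset.mem_insert_of_mem (hD p h)
        · exact h ▸ Finset.mem_insert_self _ _
      · have h1 := mul_le_mul_of_nonneg_left hcard (by linarith : 0 ≤ 1 - ε)
        -- 3δ/ε is the fixed point of x ↦ (1-ε)x + 3δ.
        have h2 : (1 - ε) * (((1 - ε) ^ n + 3 * δ / ε) * F.card) + 3 * δ * F.card =
            ((1 - ε) ^ (n + 1) + 3 * δ / ε) * F.card := by
          field_simp
          ring
        exact (add_le_add_left h1 (3 * δ * F.card)).trans h2.le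

open Classical in
/-- **Ornstein–Weiss quasi-tiling theorem**: sufficiently invariant finite sets are covered, up to
a proportion `ε`, by almost disjoint translates of finitely many prescribed Følner sets. -/
theorem exists_quasiTiling {ε : ℝ} (hε0 : 0 < ε) (hε : ε ≤ 1 / 2)
    {P : Finset S → Prop} (hP : ∃ᶠ F in leftFolner S, P F) :
    ∃ 𝒯 : Finset (Finset S), (∀ T ∈ 𝒯, P T ∧ T.Nonempty) ∧
      ∀ᶠ F in leftFolner S, ∃ D, IsQuasiTiling ε F D ∧ (∀ p ∈ D, p.1 ∈ 𝒯) ∧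
        ((F \ tileUnion D).card : ℝ) ≤ ε * F.card := by
  obtain ⟨n, hn⟩ := exists_pow_lt_of_lt_one (half_pos hε0) (by linarith : 1 - ε < 1)
  -- With δ = ε²/6 the accumulated error 3δ/ε is ε/2, the same as the bound on (1-ε)^n.
  obtain ⟨𝒯, h𝒯, hev⟩ := exists_quasiTiling_pow hε0 hε (by positivity : 0 < ε ^ 2 / 6) hP n ∅
  refine ⟨𝒯, fun T hT => ⟨(h𝒯 T hT).1, (h𝒯 T hT).2.1⟩, ?_⟩
  filter_upwards [hev] with F hF
  obtain ⟨D, hq, hD, hcard⟩ := hF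
  refine ⟨D, hq, hD, hcard.trans (mul_le_mul_of_nonneg_right ?_ (by positivity))⟩
  have : 3 * (ε ^ 2 / 6) / ε = ε / 2 := by field_simp; norm_num
  linarith

end Counting

/-! ### Limits of subadditive functions along Følner sets -/

theorem le_of_forall_le_div_add {x b M : ℝ}
    (h : ∀ ε, 0 < ε → ε ≤ 1 / 2 → x ≤ (b + ε) / (1 - ε) + M * ε) : x ≤ b := by
  have h1 : Tendsto (fun ε : ℝ => (b + ε) / (1 - ε) + M * ε) (𝓝[>] 0) (𝓝 b) := by
    have h2 : ContinuousAt (fun ε : ℝ => (b + ε) / (1 - ε) + M * ε) 0 := by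
      have : (1 : ℝ) - 0 ≠ 0 := by norm_num
      fun_prop (disch := assumption)
    have h3 := h2.tendsto
    simp only [add_zero, sub_zero, div_one, mul_zero] at h3
    exact h3.mono_left nhdsWithin_le_nhds
  refine ge_of_tendsto h1 ?_
  filter_upwards [self_mem_nhdsWithin,
    nhdsWithin_le_nhds (Iic_mem_nhds (by norm_num : (0 : ℝ) < 1 / 2))] with ε h2 h3
  exact h ε h2 h3

theorem IsQuasiTiling.sum_le_of_ratio_le {S : Type*} [Semigroup S] {ε b : ℝ} {F : Finset S}
    {D : Finset (Finset S × S)} (hq : IsQuasiTiling ε F D) (hε : ε < 1) (hb : 0 ≤ b)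
    {f : Finset S → ℝ} (hf : ∀ p ∈ D, f p.1 ≤ b * p.1.card) :
    ∑ p ∈ D, f p.1 ≤ b / (1 - ε) * F.card := by
  have h1 : ((tileUnion D).card : ℝ) ≤ F.card := by
    exact_mod_cast Finset.card_le_card hq.tileUnion_subset
  have h2 : 0 < 1 - ε := by linarith
  calc ∑ p ∈ D, f p.1 ≤ ∑ p ∈ D, b * (p.1.card : ℝ) := Finset.sum_le_sum hf
    _ = b / (1 - ε) * ((1 - ε) * ∑ p ∈ D, (p.1.card : ℝ)) := by
        rw [← Finset.mul_sum]
        field_simp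
    _ ≤ b / (1 - ε) * F.card :=
        mul_le_mul_of_nonneg_left (hq.card_le.trans h1) (by positivity)

section Fekete

variable {S : Type*} {f : Finset S → ℝ}

open Classical in
theorem le_mul_card_of_subadditive {M : ℝ} (hempty : f ∅ = 0)
    (hsub : ∀ A B, f (A ∪ B) ≤ f A + f B) (hM : ∀ s, f {s} ≤ M) (F : Finset S) :
    f F ≤ M * F.card := by
  induction F using Finset.induction_on with
  | empty => simp [hempty]
  | insert s F hs ih =>
    rw [Finset.insert_eq, Finset.card_union_of_disjoint (by simpa using hs)]
    have := hsub {s} F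
    have := hM s
    push_cast [Finset.card_singleton]
    linarith

variable [Semigroup S]

open Classical in
theorem tileUnion_le_sum (hempty : f ∅ = 0) (hsub : ∀ A B, f (A ∪ B) ≤ f A + f B)
    {g : Finset S → ℝ} {D : Finset (Finset S × S)} (htile : ∀ p ∈ D, f (tile p) ≤ g p.1) :
    f (tileUnion D) ≤ ∑ p ∈ D, g p.1 := by
  induction D using Finset.induction_on with
  | empty => simp [tileUnion, hempty]
  | insert p D hp ih =>
    have h1 : tileUnion (insert p D) = tile p ∪ tileUnion D := Finset.biUnion_insert
    rw [h1, Finset.sum_insert hp]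
    exact (hsub _ _).trans (add_le_add (htile p (Finset.mem_insert_self _ _))
      (ih fun q hq => htile q (Finset.mem_insert_of_mem hq)))

variable [IsCancelMul S] [(leftFolner S).NeBot]

open Classical in
/-- **Ornstein–Weiss lemma** for cancellative semigroups. -/
theorem exists_tendsto_of_subadditive {M : ℝ} (h0 : ∀ F, 0 ≤ f F) (hempty : f ∅ = 0)
    (hsub : ∀ A B, f (A ∪ B) ≤ f A + f B) (htile : ∀ p, f (tile p) ≤ f p.1)
    (hM : ∀ s, f {s} ≤ M) :
    ∃ l, Tendsto (fun F => f F / F.card) (leftFolner S) (𝓝 l) := by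
  have hub : ∀ F, f F ≤ M * F.card := le_mul_card_of_subadditive hempty hsub hM
  have hne : ∀ᶠ F : Finset S in leftFolner S, F.Nonempty :=
    (eventually_almostInvariant one_pos ∅).mono fun F hF => hF.1
  have hle : ∀ᶠ F in leftFolner S, f F / F.card ≤ M := by
    filter_upwards [hne] with F hF
    rw [div_le_iff₀ (by exact_mod_cast hF.card_pos)]
    exact hub F
  have hge : ∀ F : Finset S, 0 ≤ f F / F.card := fun F => div_nonneg (h0 F) (by positivity)
  have hb1 : (leftFolner S).IsBoundedUnder (· ≤ ·) fun F => f F / F.card := ⟨M, by simpa using hle⟩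
  have hb2 : (leftFolner S).IsBoundedUnder (· ≥ ·) fun F => f F / F.card :=
    ⟨0, by simpa using Eventually.of_forall hge⟩
  have hM0 : 0 ≤ M := by
    obtain ⟨F, hF⟩ := hle.exists
    exact (hge F).trans hF
  set b := liminf (fun F => f F / F.card) (leftFolner S)
  have hb0 : 0 ≤ b := le_liminf_of_le hb1.isCoboundedUnder_ge (Eventually.of_forall hge)
  refine ⟨b, tendsto_of_le_liminf_of_limsup_le le_rfl ?_ hb1 hb2⟩
  refine le_of_forall_le_div_add (M := M) fun ε hε0 hε => ?_
  -- Shapes whose ratio is close to the liminf occur frequently; tiling by them bounds the ratio of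
  -- every sufficiently invariant set, hence the limsup.
  have hfr : ∃ᶠ F in leftFolner S, f F / F.card < b + ε :=
    frequently_lt_of_liminf_lt hb1.isCoboundedUnder_ge (by linarith)
  obtain ⟨𝒯, h𝒯, hev⟩ := exists_quasiTiling hε0 hε hfr
  refine limsup_le_of_le hb2.isCoboundedUnder_le ?_
  filter_upwards [hev, hne] with F hF hFne
  obtain ⟨D, hq, hD, hcard⟩ := hF
  have hFpos : (0 : ℝ) < F.card := by exact_mod_cast hFne.card_pos
  rw [div_le_iff₀ hFpos]
  have h1 : f F ≤ f (tileUnion D) + f (F \ tileUnion D) := by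
    have := hsub (tileUnion D) (F \ tileUnion D)
    rwa [Finset.union_sdiff_of_subset hq.tileUnion_subset] at this
  have h2 : ∑ p ∈ D, f p.1 ≤ (b + ε) / (1 - ε) * F.card := by
    refine hq.sum_le_of_ratio_le (by linarith) (by linarith) fun p hp => ?_
    obtain ⟨h3, h4⟩ := h𝒯 _ (hD p hp)
    rw [div_lt_iff₀ (by exact_mod_cast h4.card_pos)] at h3
    exact h3.le
  have h3 := tileUnion_le_sum hempty hsub (D := D) fun p _ => htile p
  have h4 := (hub (F \ tileUnion D)).trans (mul_le_mul_of_nonneg_left hcard hM0)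
  linarith

end Fekete

/-! ### From an invariant mean to Følner sets -/

open MeasureTheory in
/-- An invariant mean rules out a uniformly positive sum of bounded coboundaries. -/
theorem LeftAmenable.exists_sum_lt {S : Type*} [Semigroup S] (hS : LeftAmenable S)
    (E : Finset S) {g : S → S → ℝ} {B : ℝ} (hB : ∀ s y, |g s y| ≤ B) {c : ℝ} (hc : 0 < c) :
    ∃ x, ∑ s ∈ E, (g s (s * x) - g s x) < c := by
  by_contra! hcon
  obtain ⟨μ, h01, huniv, hadd, hinv⟩ := hS
  obtain ⟨N, hN⟩ := exists_nat_gt ((E.card + 1) / c)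
  rw [div_lt_iff₀ hc] at hN
  let _ : MeasurableSpace S := ⊤
  let G : S → SimpleFunc S ℝ := fun s =>
    { toFun := fun x => (⌊N * g s x⌋ : ℝ)
      -- Rounding N·g down leaves finitely many values, so a finitely additive mean can integrate
      -- it. The |E| rounding errors are absorbed because N·c > |E| + 1.
      measurableSet_fiber' := fun _ => trivial
      finite_range' := by
        refine ((Set.finite_Icc (-(⌈N * B⌉)) ⌈N * B⌉).image (fun k : ℤ => (k : ℝ))).subset ?_
        rintro _ ⟨x, rfl⟩
        have h1 := abs_le.1 (hB s x)
        have h2 : (0 : ℝ) ≤ N := N.cast_nonneg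
        refine ⟨_, ⟨?_, ?_⟩, rfl⟩
        · rw [Int.le_floor]
          push_cast
          have := Int.le_ceil (N * B)
          nlinarith
        · have h3 : N * g s x ≤ N * B := mul_le_mul_of_nonneg_left h1.2 h2
          exact (Int.floor_le_floor h3).trans (Int.floor_le_ceil _) }
  -- `setToSimpleFunc` needs only finite additivity. The zero measure serves as a dummy, making
  -- every set of finite measure and every simple function integrable.
  let T : Set S → ℝ →L[ℝ] ℝ := fun A => μ A • ContinuousLinearMap.id ℝ ℝ
  have hT : FinMeasAdditive (0 : Measure S) T := by
    intro A A' _ _ _ _ hAA'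
    simp only [T]
    rw [hadd A A' hAA', add_smul]
  have hint : ∀ f : SimpleFunc S ℝ, Integrable f (0 : Measure S) := fun f =>
    integrable_zero_measure
  let Φ : SimpleFunc S ℝ →+ ℝ := AddMonoidHom.mk' (SimpleFunc.setToSimpleFunc T)
    fun f f' => SimpleFunc.setToSimpleFunc_add T hT (hint f) (hint f')
  let ev : S → SimpleFunc S ℝ →+ ℝ := fun x => AddMonoidHom.mk' (fun f => f x) fun f f' => rfl
  have hcomp : ∀ s (f : SimpleFunc S ℝ),
      Φ (f.comp (fun x => s * x) measurable_from_top) = Φ f := by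
    classical
    intro s f
    change SimpleFunc.setToSimpleFunc T _ = SimpleFunc.setToSimpleFunc T f
    have hsub : (f.comp (fun x => s * x) measurable_from_top).range ⊆ f.range :=
      SimpleFunc.range_comp_subset_range _ _
    rw [SimpleFunc.setToSimpleFunc_eq_sum_of_subset T hT.map_empty_eq_zero
      ((Finset.filter_subset _ _).trans hsub), SimpleFunc.setToSimpleFunc]
    refine Finset.sum_congr rfl fun y _ => ?_
    simp only [T]
    rw [SimpleFunc.coe_comp, Set.preimage_comp, hinv]
  let H : SimpleFunc S ℝ := ∑ s ∈ E, ((G s).comp (fun x => s * x) measurable_from_top - G s)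
  have hH0 : Φ H = 0 := by
    simp only [H]
    rw [map_sum]
    refine Finset.sum_eq_zero fun s _ => ?_
    rw [map_sub, hcomp, sub_self]
  have hH1 : ∀ x, 1 ≤ H x := by
    intro x
    have h1 : H x = ∑ s ∈ E, ((⌊N * g s (s * x)⌋ : ℝ) - ⌊N * g s x⌋) := by
      change ev x H = _
      simp only [H]
      rw [map_sum]
      rfl
    have h2 : ∀ s ∈ E, N * (g s (s * x) - g s x) - 1 ≤
        (⌊N * g s (s * x)⌋ : ℝ) - ⌊N * g s x⌋ := by
      intro s _
      have := Int.sub_one_lt_floor (N * g s (s * x))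
      have := Int.floor_le (N * g s x)
      linarith
    have h3 := Finset.sum_le_sum h2
    rw [Finset.sum_sub_distrib, ← Finset.mul_sum, Finset.sum_const, nsmul_eq_mul, mul_one] at h3
    have h4 := mul_le_mul_of_nonneg_left (hcon x) (N.cast_nonneg : (0 : ℝ) ≤ N)
    linarith
  have hH2 : Φ (SimpleFunc.const S 1) ≤ Φ H := by
    refine SimpleFunc.setToSimpleFunc_mono hT (fun A _ _ x hx => ?_) (hint _) (hint _)
      (fun x => hH1 x)
    simpa [T] using mul_nonneg (h01 A).1 hx
  have hH3 : Φ (SimpleFunc.const S 1) = 1 := by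
    change SimpleFunc.setToSimpleFunc T _ = _
    rw [SimpleFunc.setToSimpleFunc_const T hT.map_empty_eq_zero]
    simp [T, huniv]
  linarith

open Classical in
/-- Day's theorem: an amenable semigroup carries finitely supported probability weights that are
almost invariant in the `ℓ¹`-norm. -/
theorem LeftAmenable.exists_weights {S : Type*} [Semigroup S] (hS : LeftAmenable S)
    (E : Finset S) {ε : ℝ} (hε : 0 < ε) :
    ∃ (ι : Type) (_ : Fintype ι) (w : ι → ℝ) (x : ι → S), (∀ i, 0 ≤ w i) ∧ ∑ i, w i = 1 ∧
      ∀ s ∈ E, ∀ Y : Finset S,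
        ∑ y ∈ Y, |∑ i, w i * ((if s * x i = y then 1 else 0) - if x i = y then 1 else 0)| ≤ ε := by
  have : Fact ((1 : ℝ≥0∞) ≤ 1) := ⟨le_rfl⟩
  let X := lp (fun _ : S => ℝ) 1
  let v : S → (E → X) := fun x s => lp.single 1 (s.1 * x) (1 : ℝ) - lp.single 1 x (1 : ℝ)
  -- Otherwise Hahn–Banach separates 0 from the convex hull of the vectors (δ_{sx} - δ_x)_{s ∈ E} in
  -- ℓ¹(S)^E. The values of the functional on point masses are bounded functions g_s whose
  -- coboundary sum stays above a positive constant, which `exists_sum_lt` excludes.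
  have h0 : (0 : E → X) ∈ closure (convexHull ℝ (Set.range v)) := by
    by_contra hnot
    obtain ⟨f, u, hu0, hu⟩ := geometric_hahn_banach_point_closed
      (convex_convexHull ℝ (Set.range v)).closure isClosed_closure hnot
    rw [map_zero] at hu0
    let g : S → S → ℝ := fun s y =>
      if h : s ∈ E then f (Pi.single ⟨s, h⟩ (lp.single 1 y (1 : ℝ) : X)) else 0
    have hB : ∀ s y, |g s y| ≤ ‖f‖ := by
      intro s y
      by_cases h : s ∈ E
      · simp only [g, h, dite_true]
        refine (f.le_opNorm _).trans ?_
        rw [Pi.norm_single, lp.norm_single zero_lt_one]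
        simp
      · simp only [g, h, dite_false, abs_zero]
        exact norm_nonneg f
    obtain ⟨x, hx⟩ := hS.exists_sum_lt E hB hu0
    have h1 : f (v x) = ∑ s ∈ E, (g s (s * x) - g s x) := by
      rw [← Finset.univ_sum_single (v x), map_sum, ← Finset.sum_coe_sort E]
      refine Finset.sum_congr rfl fun s _ => ?_
      simp only [g, s.2, dite_true, v]
      rw [Pi.single_sub, map_sub]
    have h2 := hu (v x) (subset_closure (subset_convexHull ℝ _ ⟨x, rfl⟩))
    linarith
  obtain ⟨b, hb, hdist⟩ := Metric.mem_closure_iff.1 h0 ε hε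
  obtain ⟨ι, hι, w, z, hw, hw1, hz, rfl⟩ := mem_convexHull_iff_exists_fintype.1 hb
  choose x hx using hz
  refine ⟨ι, hι, w, x, hw, hw1, fun s hs Y => ?_⟩
  rw [dist_zero_left] at hdist
  have h1 := (norm_le_pi_norm (∑ i, w i • z i) ⟨s, hs⟩).trans hdist.le
  refine le_trans (le_of_eq ?_) ((lp.sum_rpow_le_norm_rpow (p := 1) (by simp)
    ((∑ i, w i • z i : E → X) ⟨s, hs⟩) Y).trans (by simpa using h1))
  refine Finset.sum_congr rfl fun y _ => ?_
  simp only [ENNReal.toReal_one, Real.rpow_one, Real.norm_eq_abs]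
  congr 1
  rw [Finset.sum_apply, lp.coeFn_sum, Finset.sum_apply]
  refine Finset.sum_congr rfl fun i _ => ?_
  rw [← hx i]
  change _ = w i * (Pi.single (M := fun _ => ℝ) (s * x i) 1 y -
    Pi.single (M := fun _ => ℝ) (x i) 1 y)
  simp only [Pi.single_apply, eq_comm]

open Classical in
/-- Namioka's trick: a level set of an almost invariant weight is almost invariant. -/
theorem exists_folner_of_weight {S : Type*} [Semigroup S] (E : Finset S) {ε : ℝ}
    (h : ∀ F : Finset S, F.Nonempty →
      ε * F.card ≤ ∑ s ∈ E, ((F.filter fun x => s * x ∉ F).card : ℝ))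
    (F : Finset S) (f : S → ℝ) (hf : ∀ x ∈ F, 0 < f x) (hf0 : ∀ x ∉ F, f x = 0) :
    ε * ∑ x ∈ F, f x ≤ ∑ s ∈ E, ∑ x ∈ F, max (f x - f (s * x)) 0 := by
  induction F using Finset.strongInduction generalizing f with
  | H F ih =>
    rcases F.eq_empty_or_nonempty with rfl | hne
    · simp
    obtain ⟨x₀, hx₀, hmin⟩ := Finset.exists_min_image F f hne
    set c := f x₀
    have hc : 0 < c := hf x₀ hx₀
    -- Peel off the lowest layer: f = c·1_F + f', with f' supported on a strictly smaller set.
    let f' : S → ℝ := fun x => if x ∈ F then f x - c else 0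
    set F' := F.filter (fun x => f x ≠ c) with hF'
    have hss : F' ⊂ F :=
      Finset.filter_ssubset.2 ⟨x₀, hx₀, by simp [c]⟩
    have hsum : ∀ φ : S → ℝ, (∀ x ∈ F, f x = c → φ x = 0) → ∑ x ∈ F, φ x = ∑ x ∈ F', φ x := by
      intro φ hφ
      symm
      refine Finset.sum_subset hss.1 fun x hx hx' => hφ x hx ?_
      by_contra hne
      exact hx' (Finset.mem_filter.2 ⟨hx, hne⟩)
    have hge : ∀ x, 0 ≤ f' x := by
      intro x
      by_cases hx : x ∈ F
      · simp only [f', hx, if_true]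
        linarith [hmin x hx]
      · simp [f', hx]
    have h1 := ih F' hss f' (fun x hx => ?_) (fun x hx => ?_)
    · rw [← hsum f' (fun x hx hxc => by simp [f', hx, hxc])] at h1
      -- The positive parts add up across layers: if sx ∈ F the constant cancels, and otherwise
      -- f(sx) = 0 and the whole value f(x) = f'(x) + c is lost.
      have h2 : ∀ s ∈ E, ∑ x ∈ F, max (f x - f (s * x)) 0 =
          ∑ x ∈ F', max (f' x - f' (s * x)) 0 + c * ((F.filter fun x => s * x ∉ F).card : ℝ) := by
        intro s _
        rw [← hsum (fun x => max (f' x - f' (s * x)) 0) (fun x hx hxc => ?_)]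
        · rw [Finset.card_filter, Nat.cast_sum, Finset.mul_sum, ← Finset.sum_add_distrib]
          refine Finset.sum_congr rfl fun x hx => ?_
          by_cases hsx : s * x ∈ F
          · simp [f', hx, hsx]
          · have h3 : 0 ≤ f x - c := by linarith [hmin x hx]
            simp only [f', hx, hsx, if_true, if_false, hf0 _ hsx, sub_zero, not_false_eq_true,
              Nat.cast_one, mul_one]
            rw [max_eq_left h3, max_eq_left (by linarith)]
            ring
        · have h3 := hge (s * x)
          have h4 : f' x = 0 := by simp [f', hx, hxc]
          rw [h4]
          exact max_eq_right (by linarith)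
      rw [Finset.sum_congr rfl h2, Finset.sum_add_distrib, ← Finset.mul_sum]
      have h3 : ∑ x ∈ F, f x = ∑ x ∈ F, f' x + c * F.card := by
        rw [mul_comm, ← nsmul_eq_mul, ← Finset.sum_const, ← Finset.sum_add_distrib]
        refine Finset.sum_congr rfl fun x hx => ?_
        simp [f', hx]
      have h4 := mul_le_mul_of_nonneg_left (h F hne) hc.le
      rw [h3]
      linarith
    · obtain ⟨hxF, hxc⟩ := Finset.mem_filter.1 hx
      simp only [f', hxF, if_true]
      exact sub_pos.2 (lt_of_le_of_ne (hmin x hxF) (Ne.symm hxc))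
    · by_cases hxF : x ∈ F
      · have : f x = c := by
          by_contra hne
          exact hx (Finset.mem_filter.2 ⟨hxF, hne⟩)
        simp [f', this]
      · simp [f', hxF]

open Classical in
/-- **Følner's theorem** for left cancellative, left amenable semigroups. -/
theorem LeftAmenable.exists_almostInvariant {S : Type*} [Semigroup S] [IsLeftCancelMul S]
    (hS : LeftAmenable S) {δ : ℝ} (hδ : 0 < δ) (E : Finset S) :
    ∃ F, AlmostInvariant δ E F := by
  by_contra! hcon
  have hbad : ∀ F : Finset S, F.Nonempty →
      δ * F.card ≤ ∑ s ∈ E, ((F.filter fun x => s * x ∉ F).card : ℝ) := by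
    intro F hF
    have h1 : ¬ ∀ k ∈ E, folnerRatio k F ≤ δ := fun h => hcon F ⟨hF, h⟩
    push Not at h1
    obtain ⟨k, hk, hlt⟩ := h1
    have hFpos : (0 : ℝ) < F.card := by exact_mod_cast hF.card_pos
    unfold folnerRatio at hlt
    rw [lt_div_iff₀ hFpos] at hlt
    have h2 : (F.image (fun x => k * x) \ F).card ≤ (F.filter fun x => k * x ∉ F).card := by
      refine (Finset.card_le_card ?_).trans (Finset.card_image_le (f := fun x => k * x))
      intro y hy
      obtain ⟨hy1, hy2⟩ := Finset.mem_sdiff.1 hy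
      obtain ⟨x, hx, rfl⟩ := Finset.mem_image.1 hy1
      exact Finset.mem_image_of_mem _ (Finset.mem_filter.2 ⟨hx, hy2⟩)
    have h3 : ((F.image (fun x => k * x) \ F).card : ℝ) ≤ (F.filter fun x => k * x ∉ F).card := by
      exact_mod_cast h2
    have h4 := Finset.single_le_sum
      (f := fun s => ((F.filter fun x => s * x ∉ F).card : ℝ)) (fun _ _ => by positivity) hk
    linarith
  set η := δ / (2 * (E.card + 1)) with hη
  obtain ⟨ι, _, w, z, hw, hw1, hY⟩ := hS.exists_weights E (by positivity : 0 < η)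
  let f : S → ℝ := fun y => ∑ i, w i * if z i = y then 1 else 0
  have hf0 : ∀ y, 0 ≤ f y := fun y => Finset.sum_nonneg fun i _ =>
    mul_nonneg (hw i) (by split_ifs <;> norm_num)
  set F := (Finset.univ.image z).filter (fun y => f y ≠ 0)
  have hmem : ∀ y ∉ F, f y = 0 := by
    intro y hy
    by_cases hyz : y ∈ Finset.univ.image z
    · by_contra hne
      exact hy (Finset.mem_filter.2 ⟨hyz, hne⟩)
    · refine Finset.sum_eq_zero fun i _ => ?_
      rw [if_neg, mul_zero]
      rintro rfl
      exact hyz (Finset.mem_image_of_mem _ (Finset.mem_univ i))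
  have hsum1 : ∑ y ∈ F, f y = 1 := by
    have h1 : ∑ y ∈ F, f y = ∑ y ∈ Finset.univ.image z, f y :=
      Finset.sum_subset (Finset.filter_subset _ _) fun y _ hy => hmem y hy
    rw [h1]
    simp only [f]
    rw [Finset.sum_comm]
    refine (Finset.sum_congr rfl fun i _ => ?_).trans hw1
    rw [← Finset.mul_sum, Finset.sum_ite_eq, if_pos (Finset.mem_image_of_mem _ (Finset.mem_univ i)),
      mul_one]
  have h1 := exists_folner_of_weight E hbad F f
    (fun y hy => lt_of_le_of_ne (hf0 y) (Ne.symm (Finset.mem_filter.1 hy).2)) hmem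
  rw [hsum1, mul_one] at h1
  have h2 : ∀ s ∈ E, ∑ x ∈ F, max (f x - f (s * x)) 0 ≤ η := by
    intro s hs
    -- By left cancellation the push-forward of f under s takes the value f(x) at sx, so f(x) -
    -- f(sx) is the defect of invariance at sx.
    refine le_trans ?_ (hY s hs (F.image fun x => s * x))
    rw [Finset.sum_image (mul_right_injective s).injOn]
    refine Finset.sum_le_sum fun x _ => ?_
    have h3 : ∑ i, w i * ((if s * z i = s * x then 1 else 0) - if z i = s * x then 1 else 0) =
        f x - f (s * x) := by
      simp only [f, mul_sub, Finset.sum_sub_distrib, mul_right_inj]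
    rw [h3]
    exact max_le (le_abs_self _) (abs_nonneg _)
  have h3 := Finset.sum_le_sum h2
  rw [Finset.sum_const, nsmul_eq_mul] at h3
  have h4 : E.card * η < δ := by
    rw [hη, mul_div_assoc', div_lt_iff₀ (by positivity)]
    nlinarith
  linarith

theorem LeftAmenable.neBot_leftFolner {S : Type*} [Semigroup S] [IsLeftCancelMul S]
    (hS : LeftAmenable S) : (leftFolner S).NeBot := by
  classical
  choose F hF using fun p : Finset S × ℕ =>
    hS.exists_almostInvariant (Nat.one_div_pos_of_nat (α := ℝ) (n := p.2)) p.1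
  have h : Tendsto F atTop (leftFolner S) := by
    rw [tendsto_leftFolner_iff]
    refine ⟨Eventually.of_forall fun p => (hF p).1, fun s => ?_⟩
    have h1 : Tendsto (fun p : Finset S × ℕ => 1 / ((p.2 : ℝ) + 1)) atTop (𝓝 0) := by
      rw [← prod_atTop_atTop_eq]
      exact tendsto_one_div_add_atTop_nhds_zero_nat.comp tendsto_snd
    refine squeeze_zero' (Eventually.of_forall fun p => ?_) ?_ h1
    · unfold folnerRatio
      positivity
    · filter_upwards [eventually_ge_atTop (({s} : Finset S), 0)] with p hp
      exact (hF p).2 s (hp.1 (Finset.mem_singleton_self s))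
  exact h.neBot

/-! ### Cover numbers and existence of the entropy -/

section Cover

variable {C : Type*}

theorem coverNumber_le_card [Nonempty C] {𝒲 : Set (Set C)} {ι : Type*} (t : Finset ι)
    (A : ι → Set C) (hA : ∀ i ∈ t, ∃ W ∈ 𝒲, A i ⊆ W) (hcov : ∀ x, ∃ i ∈ t, x ∈ A i) :
    coverNumber 𝒲 ≤ t.card := by
  classical
  choose! W hW hAW using hA
  refine le_trans (Nat.sInf_le ⟨?_, t.image W, ?_, ?_, rfl⟩) Finset.card_image_le
  · obtain ⟨i, hi, -⟩ := hcov (Classical.arbitrary C)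
    exact Finset.card_pos.2 ⟨W i, Finset.mem_image_of_mem _ hi⟩
  · intro V hV
    obtain ⟨i, hi, rfl⟩ := Finset.mem_image.1 (Finset.mem_coe.1 hV)
    exact hW i hi
  · refine Set.eq_univ_of_forall fun x => ?_
    obtain ⟨i, hi, hx⟩ := hcov x
    exact ⟨W i, Finset.mem_coe.2 (Finset.mem_image_of_mem _ hi), hAW i hi hx⟩

/-- Compactness makes the set under `sInf` non-empty, so the infimum is attained and is not the
default value 0. -/
theorem exists_card_eq_coverNumber [TopologicalSpace C] [CompactSpace C] [Nonempty C]
    {𝒰 : Set (Set C)} (h : OpenCover 𝒰) :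
    0 < coverNumber 𝒰 ∧ ∃ 𝒱 : Finset (Set C), (∀ V ∈ 𝒱, V ∈ 𝒰) ∧ (∀ x, ∃ V ∈ 𝒱, x ∈ V) ∧
      𝒱.card = coverNumber 𝒰 := by
  have hne : {n : ℕ | 0 < n ∧ ∃ 𝒱 : Finset (Set C), (𝒱 : Set (Set C)) ⊆ 𝒰 ∧
      ⋃₀ (𝒱 : Set (Set C)) = Set.univ ∧ 𝒱.card = n}.Nonempty := by
    obtain ⟨T, hT, hfin, hcov⟩ := isCompact_univ.elim_finite_subcover_image (b := 𝒰) (c := id)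
      h.1 (by rw [← h.2, Set.sUnion_eq_biUnion]; rfl)
    have hcov' : ∀ x, ∃ V ∈ T, x ∈ V := fun x => by simpa using hcov (Set.mem_univ x)
    refine ⟨hfin.toFinset.card, ?_, hfin.toFinset, by simpa using hT, ?_, rfl⟩
    · obtain ⟨V, hV, -⟩ := hcov' (Classical.arbitrary C)
      exact Finset.card_pos.2 ⟨V, by simpa using hV⟩
    · rw [hfin.coe_toFinset]
      exact Set.eq_univ_of_forall hcov'
  obtain ⟨hpos, 𝒱, hsub, hcov, hcard⟩ := Nat.sInf_mem hne
  refine ⟨hpos, 𝒱, fun V hV => hsub hV, fun x => ?_, hcard⟩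
  obtain ⟨V, hV, hx⟩ := hcov.ge (Set.mem_univ x)
  exact ⟨V, hV, hx⟩

theorem coverNumber_le_of_forall_preimage {C' : Type*} [Nonempty C] [TopologicalSpace C']
    [CompactSpace C'] [Nonempty C'] {𝒲 : Set (Set C)} {𝒰 : Set (Set C')} (h𝒰 : OpenCover 𝒰)
    (φ : C → C') (h : ∀ U ∈ 𝒰, ∃ W ∈ 𝒲, φ ⁻¹' U ⊆ W) : coverNumber 𝒲 ≤ coverNumber 𝒰 := by
  obtain ⟨-, 𝒱, hsub, hcov, hcard⟩ := exists_card_eq_coverNumber h𝒰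
  rw [← hcard]
  exact coverNumber_le_card 𝒱 (fun V => φ ⁻¹' V) (fun V hV => h V (hsub V hV)) fun x => hcov (φ x)

theorem coverNumber_le_mul [TopologicalSpace C] [CompactSpace C] [Nonempty C]
    {𝒲 𝒰 𝒰' : Set (Set C)} (h𝒰 : OpenCover 𝒰) (h𝒰' : OpenCover 𝒰')
    (h : ∀ U ∈ 𝒰, ∀ U' ∈ 𝒰', ∃ W ∈ 𝒲, U ∩ U' ⊆ W) :
    coverNumber 𝒲 ≤ coverNumber 𝒰 * coverNumber 𝒰' := by
  obtain ⟨-, 𝒱, hsub, hcov, hcard⟩ := exists_card_eq_coverNumber h𝒰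
  obtain ⟨-, 𝒱', hsub', hcov', hcard'⟩ := exists_card_eq_coverNumber h𝒰'
  rw [← hcard, ← hcard', ← Finset.card_product]
  refine coverNumber_le_card (𝒱 ×ˢ 𝒱') (fun p => p.1 ∩ p.2) (fun p hp => ?_) fun x => ?_
  · obtain ⟨h1, h2⟩ := Finset.mem_product.1 hp
    exact h _ (hsub _ h1) _ (hsub' _ h2)
  · obtain ⟨V, hV, hx⟩ := hcov x
    obtain ⟨V', hV', hx'⟩ := hcov' x
    exact ⟨(V, V'), Finset.mem_product.2 ⟨hV, hV'⟩, hx, hx'⟩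

theorem OpenCover.joinCover {S : Type*} [TopologicalSpace C] {γ : S → C → C}
    (hγ : ∀ s, Continuous (γ s)) {𝒰 : Set (Set C)} (h𝒰 : OpenCover 𝒰) (F : Finset S) :
    OpenCover (joinCover γ 𝒰 F) := by
  refine ⟨?_, Set.eq_univ_of_forall fun x => ?_⟩
  · rintro _ ⟨V, hV, rfl⟩
    exact isOpen_biInter_finset fun s hs => (h𝒰.1 _ (hV s hs)).preimage (hγ s)
  · have h : ∀ s, ∃ U ∈ 𝒰, γ s x ∈ U := fun s => h𝒰.2.ge (Set.mem_univ (γ s x))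
    choose V hV hx using h
    exact ⟨_, ⟨V, fun s _ => hV s, rfl⟩, Set.mem_iInter₂.2 fun s _ => hx s⟩

variable {S : Type*} [TopologicalSpace C] [CompactSpace C] [Nonempty C] {γ : S → C → C}

theorem log_coverNumber_mono {𝒲 𝒰 : Set (Set C)} (h𝒰 : OpenCover 𝒰)
    (h : ∀ U ∈ 𝒰, ∃ W ∈ 𝒲, U ⊆ W) :
    Real.log (coverNumber 𝒲) ≤ Real.log (coverNumber 𝒰) := by
  rcases Nat.eq_zero_or_pos (coverNumber 𝒲) with h0 | h0
  · rw [h0]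
    simpa using Real.log_natCast_nonneg _
  · exact Real.log_le_log (by exact_mod_cast h0)
      (by exact_mod_cast coverNumber_le_of_forall_preimage h𝒰 id h)

theorem entropyRatio_mono (hγ : ∀ s, Continuous (γ s)) {𝒲 𝒰 : Set (Set C)} (h𝒰 : OpenCover 𝒰)
    (h : ∀ U ∈ 𝒰, ∃ W ∈ 𝒲, U ⊆ W) (F : Finset S) :
    entropyRatio γ 𝒲 F ≤ entropyRatio γ 𝒰 F := by
  refine div_le_div_of_nonneg_right (log_coverNumber_mono (h𝒰.joinCover hγ F) ?_) (by positivity)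
  rintro _ ⟨V, hV, rfl⟩
  choose! W hW hVW using h
  exact ⟨_, ⟨fun s => W (V s), fun s hs => hW _ (hV s hs), rfl⟩,
    Set.iInter₂_mono fun s hs => Set.preimage_mono (hVW _ (hV s hs))⟩

/-- The topological entropy of an action of a cancellative left amenable semigroup on a compact
space by continuous maps is well defined. -/
theorem topEntropyWellDefined [Semigroup S] [IsCancelMul S] (hS : LeftAmenable S)
    (hγ : ∀ s, Continuous (γ s)) (hmul : ∀ s t x, γ (s * t) x = γ s (γ t x)) :
    TopEntropyWellDefined γ := by
  classical
  have hne := hS.neBot_leftFolner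
  refine ⟨hne, fun 𝒰 h𝒰 => ?_⟩
  refine tendsto_nhds_limUnder (exists_tendsto_of_subadditive (S := S)
    (f := fun F => Real.log (coverNumber (joinCover γ 𝒰 F))) (M := Real.log (coverNumber 𝒰))
    (fun F => Real.log_natCast_nonneg _) ?_ ?_ ?_ ?_)
  · have h1 : coverNumber (joinCover γ 𝒰 (∅ : Finset S)) ≤ 1 := by
      refine coverNumber_le_card (Finset.univ : Finset Unit) (fun _ => Set.univ)
        (fun _ _ => ⟨_, ⟨fun _ => ∅, by simp, rfl⟩, by simp⟩) fun x => ⟨(), by simp⟩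
    rw [Real.log_eq_zero]
    have := (exists_card_eq_coverNumber (h𝒰.joinCover hγ ∅)).1
    exact Or.inr (Or.inl (by exact_mod_cast (by omega : coverNumber (joinCover γ 𝒰 ∅) = 1)))
  · intro A B
    have hA := exists_card_eq_coverNumber (h𝒰.joinCover hγ A)
    have hB := exists_card_eq_coverNumber (h𝒰.joinCover hγ B)
    have hAB := exists_card_eq_coverNumber (h𝒰.joinCover hγ (A ∪ B))
    rw [← Real.log_mul (by exact_mod_cast hA.1.ne') (by exact_mod_cast hB.1.ne')]
    refine Real.log_le_log (by exact_mod_cast hAB.1) ?_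
    norm_cast
    refine coverNumber_le_mul (h𝒰.joinCover hγ A) (h𝒰.joinCover hγ B) ?_
    rintro _ ⟨V, hV, rfl⟩ _ ⟨V', hV', rfl⟩
    refine ⟨_, ⟨fun s => if s ∈ A then V s else V' s, fun s hs => ?_, rfl⟩, ?_⟩
    · by_cases hsA : s ∈ A
      · simpa [hsA] using hV s hsA
      · simpa [hsA] using hV' s ((Finset.mem_union.1 hs).resolve_left hsA)
    · rintro x ⟨hx, hx'⟩
      rw [Set.mem_iInter₂] at hx hx' ⊢
      intro s hs
      by_cases hsA : s ∈ A
      · simpa [hsA] using hx s hsA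
      · simpa [hsA] using hx' s ((Finset.mem_union.1 hs).resolve_left hsA)
  · rintro ⟨T, c⟩
    have hT := exists_card_eq_coverNumber (h𝒰.joinCover hγ (tile (T, c)))
    refine Real.log_le_log (by exact_mod_cast hT.1) ?_
    norm_cast
    refine coverNumber_le_of_forall_preimage (h𝒰.joinCover hγ T) (γ c) ?_
    rintro _ ⟨V, hV, rfl⟩
    have hinj := mul_left_injective c
    -- Right cancellation makes t ↦ tc injective, so a choice of members indexed by T transfers to
    -- Tc; the value off the tile is irrelevant.
    refine ⟨_, ⟨Function.extend (fun t => t * c) V fun _ => ∅, fun s hs => ?_, rfl⟩, ?_⟩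
    · obtain ⟨t, ht, rfl⟩ := Finset.mem_image.1 hs
      rw [hinj.extend_apply]
      exact hV t ht
    · intro x hx
      rw [Set.mem_preimage, Set.mem_iInter₂] at hx
      rw [Set.mem_iInter₂]
      intro s hs
      obtain ⟨t, ht, rfl⟩ := Finset.mem_image.1 hs
      simp only [Set.mem_preimage]
      rw [hinj.extend_apply, hmul]
      exact hx t ht
  · intro s
    have hs := exists_card_eq_coverNumber (h𝒰.joinCover hγ {s})
    refine Real.log_le_log (by exact_mod_cast hs.1) ?_
    norm_cast
    refine coverNumber_le_of_forall_preimage h𝒰 (γ s) fun U hU => ?_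
    exact ⟨_, ⟨fun _ => U, fun _ _ => hU, rfl⟩, by simp⟩

theorem TopEntropyWellDefined.coverEntropy_mono [Semigroup S] (h : TopEntropyWellDefined γ)
    (hγ : ∀ s, Continuous (γ s)) {𝒲 𝒰 : Set (Set C)} (h𝒲 : OpenCover 𝒲) (h𝒰 : OpenCover 𝒰)
    (hr : ∀ U ∈ 𝒰, ∃ W ∈ 𝒲, U ⊆ W) : coverEntropy γ 𝒲 ≤ coverEntropy γ 𝒰 :=
  have := h.1
  le_of_tendsto_of_tendsto' (h.2 𝒲 h𝒲) (h.2 𝒰 h𝒰) (entropyRatio_mono hγ h𝒰 hr)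

end Cover

/-! ### Entropy through cosets of open subgroups -/

section Coset

/-- The cover of a group by the cosets of a subgroup. -/
def cosetCover {G : Type*} [AddCommGroup G] (H : AddSubgroup G) : Set (Set G) :=
  Set.range fun x => {y | y - x ∈ H}

/-- The subgroup `⋂_{s ∈ F} γ(s)⁻¹(H)`. -/
def joinSubgroup {S G : Type*} [Semigroup S] [AddCommGroup G] (γ : S →ₙ* AddMonoid.End G)
    (H : AddSubgroup G) (F : Finset S) : AddSubgroup G :=
  ⨅ s ∈ F, H.comap (γ s)

variable {S G : Type*} [Semigroup S] [AddCommGroup G] {γ : S →ₙ* AddMonoid.End G}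
  {H : AddSubgroup G}

theorem mem_joinSubgroup {F : Finset S} {x : G} :
    x ∈ joinSubgroup γ H F ↔ ∀ s ∈ F, γ s x ∈ H := by
  simp only [joinSubgroup, AddSubgroup.mem_iInf]
  rfl

variable [TopologicalSpace G]

theorem isOpen_joinSubgroup (hγ : ∀ s, Continuous (γ s)) (hH : IsOpen (H : Set G))
    (F : Finset S) : IsOpen (joinSubgroup γ H F : Set G) := by
  have : (joinSubgroup γ H F : Set G) = ⋂ s ∈ F, γ s ⁻¹' H := by
    ext x
    simp [mem_joinSubgroup]
  rw [this]
  exact isOpen_biInter_finset fun s _ => hH.preimage (hγ s)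

variable [IsTopologicalAddGroup G]

theorem openCover_cosetCover (hH : IsOpen (H : Set G)) : OpenCover (cosetCover H) := by
  refine ⟨?_, Set.eq_univ_of_forall fun x => ⟨_, ⟨x, rfl⟩, by simp [H.zero_mem]⟩⟩
  rintro _ ⟨x, rfl⟩
  exact hH.preimage (continuous_id.sub continuous_const)

variable [CompactSpace G]

theorem index_ne_zero_of_isOpen (hH : IsOpen (H : Set G)) : H.index ≠ 0 := by
  have := H.quotient_finite_of_isOpen hH
  exact AddSubgroup.index_ne_zero_of_finite

/-- A member of the join is empty or a coset of `joinSubgroup γ H F`. Cosets are disjoint, so a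
subcover must contain all of them. -/
theorem coverNumber_joinCover_cosetCover (hγ : ∀ s, Continuous (γ s)) (hH : IsOpen (H : Set G))
    (F : Finset S) :
    coverNumber (joinCover (fun s => γ s) (cosetCover H) F) = (joinSubgroup γ H F).index := by
  have hfin := (joinSubgroup γ H F).quotient_finite_of_isOpen (isOpen_joinSubgroup hγ hH F)
  have := Fintype.ofFinite (G ⧸ joinSubgroup γ H F)
  rw [AddSubgroup.index_eq_card, Nat.card_eq_fintype_card]
  apply le_antisymm
  · rw [← Finset.card_univ]
    refine coverNumber_le_card Finset.univ (fun q => {y : G | (y : G ⧸ joinSubgroup γ H F) = q})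
      (fun q _ => ?_) fun x => ⟨_, Finset.mem_univ _, rfl⟩
    refine ⟨_, ⟨fun s => {y | y - γ s q.out ∈ H}, fun s _ => ⟨_, rfl⟩, rfl⟩, fun y hy => ?_⟩
    rw [Set.mem_iInter₂]
    intro s hs
    have hy' : (q.out : G ⧸ joinSubgroup γ H F) = (y : G ⧸ joinSubgroup γ H F) := by
      rw [QuotientAddGroup.out_eq']
      exact hy.symm
    rw [QuotientAddGroup.eq, mem_joinSubgroup] at hy'
    have := hy' s hs
    rw [map_add, map_neg, neg_add_eq_sub] at this
    exact this
  · obtain ⟨-, 𝒱, hsub, hcov, hcard⟩ := exists_card_eq_coverNumber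
      ((openCover_cosetCover hH).joinCover (γ := fun s => γ s) hγ F)
    rw [← hcard]
    choose V hV hmem using hcov
    rw [← Fintype.card_coe 𝒱]
    refine Fintype.card_le_of_injective
      (fun q : G ⧸ joinSubgroup γ H F => (⟨V q.out, hV q.out⟩ : 𝒱)) fun q q' hqq' => ?_
    have h1 := hmem q.out
    have h2 := hmem q'.out
    rw [← Subtype.mk.inj hqq'] at h2
    obtain ⟨W, hW, hVW⟩ := hsub _ (hV q.out)
    rw [hVW, Set.mem_iInter₂] at h1 h2
    rw [← QuotientAddGroup.out_eq' q, ← QuotientAddGroup.out_eq' q', QuotientAddGroup.eq,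
      mem_joinSubgroup]
    intro s hs
    obtain ⟨z, hz⟩ := hW s hs
    have h3 := h1 s hs
    have h4 := h2 s hs
    rw [Set.mem_preimage, ← hz] at h3 h4
    have := H.sub_mem h4 h3
    rw [sub_sub_sub_cancel_right] at this
    rwa [map_add, map_neg, neg_add_eq_sub]

/-- This is the Lebesgue number lemma for the uniformity of the compact group; it lets cosets of
small open subgroups refine any open cover. -/
theorem OpenCover.exists_nhds_zero {𝒰 : Set (Set G)} (h𝒰 : OpenCover 𝒰) :
    ∃ N ∈ 𝓝 (0 : G), ∀ x, ∃ U ∈ 𝒰, ∀ y, y - x ∈ N → y ∈ U := by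
  let _ : UniformSpace G := IsTopologicalAddGroup.rightUniformSpace G
  have : IsUniformAddGroup G := isUniformAddGroup_of_addCommGroup
  obtain ⟨V, hV, h⟩ := lebesgue_number_lemma_sUnion isCompact_univ h𝒰.1 h𝒰.2.ge
  rw [uniformity_eq_comap_nhds_zero, mem_comap] at hV
  obtain ⟨N, hN, hNV⟩ := hV
  refine ⟨N, hN, fun x => ?_⟩
  obtain ⟨U, hU, hxU⟩ := h x (Set.mem_univ x)
  exact ⟨U, hU, fun y hy => hxU (hNV (show (x, y) ∈ _ from hy))⟩

theorem topEntropy_eq_iSup_cosetCover (hwd : TopEntropyWellDefined fun s => γ s)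
    (hγ : ∀ s, Continuous (γ s)) {ι : Type*} {J : ι → AddSubgroup G}
    (hJ : ∀ i, IsOpen (J i : Set G)) (hbasis : ∀ N ∈ 𝓝 (0 : G), ∃ i, (J i : Set G) ⊆ N) :
    topEntropy (fun s => γ s) =
      ⨆ i, ENNReal.ofReal (coverEntropy (fun s => γ s) (cosetCover (J i))) := by
  apply le_antisymm
  · refine iSup₂_le fun 𝒰 h𝒰 => ?_
    obtain ⟨N, hN, h⟩ := h𝒰.exists_nhds_zero
    obtain ⟨i, hi⟩ := hbasis N hN
    refine le_iSup_of_le i (ENNReal.ofReal_le_ofReal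
      (hwd.coverEntropy_mono hγ h𝒰 (openCover_cosetCover (hJ i)) ?_))
    rintro _ ⟨x, rfl⟩
    obtain ⟨U, hU, hxU⟩ := h x
    exact ⟨U, hU, fun y hy => hxU y (hi hy)⟩
  · exact iSup_le fun i => le_iSup₂_of_le _ (openCover_cosetCover (hJ i)) le_rfl

theorem TopEntropyWellDefined.tendsto_log_index (hwd : TopEntropyWellDefined fun s => γ s)
    (hγ : ∀ s, Continuous (γ s)) (hH : IsOpen (H : Set G)) :
    Tendsto (fun F => Real.log (joinSubgroup γ H F).index / F.card) (leftFolner S)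
      (𝓝 (coverEntropy (fun s => γ s) (cosetCover H))) := by
  refine (hwd.2 _ (openCover_cosetCover hH)).congr fun F => ?_
  rw [entropyRatio, coverNumber_joinCover_cosetCover hγ hH]

end Coset

/-! ### Index inequalities -/

section Index

variable {S G : Type*} [Semigroup S] [AddCommGroup G] {γ : S →ₙ* AddMonoid.End G}
  {L : AddSubgroup G}

theorem joinSubgroup_mono {H H' : AddSubgroup G} (h : H ≤ H') (F : Finset S) :
    joinSubgroup γ H F ≤ joinSubgroup γ H' F := by
  intro x hx
  rw [mem_joinSubgroup] at hx ⊢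
  exact fun s hs => h (hx s hs)

theorem joinSubgroup_anti (H : AddSubgroup G) {F F' : Finset S} (h : F ⊆ F') :
    joinSubgroup γ H F' ≤ joinSubgroup γ H F := by
  intro x hx
  rw [mem_joinSubgroup] at hx ⊢
  exact fun s hs => hx s (h hs)

open Classical in
theorem joinSubgroup_union (H : AddSubgroup G) (A B : Finset S) :
    joinSubgroup γ H (A ∪ B) = joinSubgroup γ H A ⊓ joinSubgroup γ H B := by
  ext x
  simp only [AddSubgroup.mem_inf, mem_joinSubgroup, Finset.mem_union]
  exact ⟨fun h => ⟨fun s hs => h s (Or.inl hs), fun s hs => h s (Or.inr hs)⟩,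
    fun h s hs => hs.elim (h.1 s) (h.2 s)⟩

theorem joinSubgroup_tile (H : AddSubgroup G) (p : Finset S × S) :
    joinSubgroup γ H (tile p) = (joinSubgroup γ H p.1).comap (γ p.2) := by
  ext x
  refine mem_joinSubgroup.trans (Iff.trans ?_
    (mem_joinSubgroup (γ := γ) (H := H) (F := p.1) (x := γ p.2 x)).symm)
  simp only [tile, Finset.forall_mem_image, map_mul]
  rfl

theorem joinSubgroup_singleton (H : AddSubgroup G) (s : S) :
    joinSubgroup γ H {s} = H.comap (γ s) := by
  simp [joinSubgroup]

theorem joinSubgroup_restrictAction (hL : Invariant γ L) (H : AddSubgroup G) (F : Finset S) :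
    joinSubgroup (restrictAction γ L hL) (H.addSubgroupOf L) F =
      (joinSubgroup γ H F).addSubgroupOf L := by
  ext x
  rw [AddSubgroup.mem_addSubgroupOf, mem_joinSubgroup, mem_joinSubgroup]
  rfl

theorem comap_joinSubgroup_quotientAction (hL : Invariant γ L) (H : AddSubgroup G)
    (F : Finset S) :
    (joinSubgroup (quotientAction γ L hL) (H.map (QuotientAddGroup.mk' L)) F).comap
      (QuotientAddGroup.mk' L) = joinSubgroup γ (H ⊔ L) F := by
  have h : (H.map (QuotientAddGroup.mk' L)).comap (QuotientAddGroup.mk' L) = H ⊔ L := by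
    rw [AddSubgroup.comap_map_eq, QuotientAddGroup.ker_mk']
  ext x
  rw [AddSubgroup.mem_comap, mem_joinSubgroup, mem_joinSubgroup, ← h]
  rfl

theorem index_joinSubgroup_quotientAction (hL : Invariant γ L) (H : AddSubgroup G)
    (F : Finset S) :
    (joinSubgroup (quotientAction γ L hL) (H.map (QuotientAddGroup.mk' L)) F).index =
      (joinSubgroup γ (H ⊔ L) F).index := by
  rw [← comap_joinSubgroup_quotientAction hL,
    AddSubgroup.index_comap_of_surjective _ (QuotientAddGroup.mk'_surjective L)]

theorem joinSubgroup_sup_le (hL : Invariant γ L) (H : AddSubgroup G) (F : Finset S) :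
    joinSubgroup γ H F ⊔ L ≤ joinSubgroup γ (H ⊔ L) F := by
  refine sup_le (joinSubgroup_mono le_sup_left F) fun x hx => ?_
  rw [mem_joinSubgroup]
  exact fun s _ => AddSubgroup.mem_sup_right (hL s x hx)

theorem relIndex_ne_zero_of_index_ne_zero {H : AddSubgroup G} (h : H.index ≠ 0)
    (W : AddSubgroup G) : H.relIndex W ≠ 0 :=
  fun h0 => h (AddSubgroup.index_eq_zero_of_relIndex_eq_zero h0)

theorem relIndex_le_index {H : AddSubgroup G} (h : H.index ≠ 0) (W : AddSubgroup G) :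
    H.relIndex W ≤ H.index :=
  Nat.le_of_dvd (Nat.pos_of_ne_zero h) (AddSubgroup.relIndex_dvd_index_of_normal H W)

theorem index_le_of_le {H H' : AddSubgroup G} (h : H.index ≠ 0) (hle : H ≤ H') :
    H'.index ≤ H.index :=
  Nat.le_of_dvd (Nat.pos_of_ne_zero h) (AddSubgroup.index_dvd_of_le hle)

/-- Split the index of H_F along H_F ≤ H_F + L ≤ G. The first factor is [L : L ∩ H_F], and H_F + L ≤
(H + L)_F because L is invariant. -/
theorem log_relIndex_add_log_index_le (hL : Invariant γ L) {H : AddSubgroup G} {F : Finset S}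
    (h : (joinSubgroup γ H F).index ≠ 0) :
    Real.log ((joinSubgroup γ H F).relIndex L) + Real.log (joinSubgroup γ (H ⊔ L) F).index ≤
      Real.log (joinSubgroup γ H F).index := by
  have h1 := AddSubgroup.relIndex_mul_index (le_sup_left (a := joinSubgroup γ H F) (b := L))
  rw [AddSubgroup.relIndex_sup_left] at h1
  have h2 : (joinSubgroup γ H F ⊔ L).index ≠ 0 := by
    intro h0
    rw [h0, mul_zero] at h1
    exact h h1.symm
  have h3 := index_le_of_le h2 (joinSubgroup_sup_le hL H F)
  have h4 : (joinSubgroup γ (H ⊔ L) F).index ≠ 0 := fun h0 =>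
    h2 (Nat.eq_zero_of_zero_dvd (h0 ▸ AddSubgroup.index_dvd_of_le (joinSubgroup_sup_le hL H F)))
  rw [← h1, Nat.cast_mul, Real.log_mul
    (by exact_mod_cast relIndex_ne_zero_of_index_ne_zero h L) (by exact_mod_cast h2)]
  have h5 : (0 : ℝ) < (joinSubgroup γ (H ⊔ L) F).index := by
    exact_mod_cast Nat.pos_of_ne_zero h4
  gcongr

-- Split the index of H_F through W = (N + L)_F. The function A ↦ log[W : W ∩ H_A] is subadditive,
-- and on a tile it is controlled by L alone.
open Classical in
theorem log_index_joinSubgroup_le {H N : AddSubgroup G}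
    (hH : ∀ F : Finset S, (joinSubgroup γ H F).index ≠ 0) (hH0 : H.index ≠ 0)
    {ε : ℝ} {F : Finset S} {D : Finset (Finset S × S)} (hq : IsQuasiTiling ε F D)
    (hN : ∀ p ∈ D, N ≤ joinSubgroup γ H p.1)
    (hNF : (joinSubgroup γ (N ⊔ L) F).index ≠ 0) :
    Real.log (joinSubgroup γ H F).index ≤ Real.log (joinSubgroup γ (N ⊔ L) F).index +
      ∑ p ∈ D, Real.log ((joinSubgroup γ H p.1).relIndex L) +
      Real.log H.index * (F \ tileUnion D).card := by
  set W := joinSubgroup γ (N ⊔ L) F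
  let ψ : Finset S → ℝ := fun A => Real.log ((joinSubgroup γ H A).relIndex W)
  have hrel : ∀ A : Finset S, (joinSubgroup γ H A).relIndex W ≠ 0 := fun A =>
    relIndex_ne_zero_of_index_ne_zero (hH A) W
  have hempty : ψ ∅ = 0 := by simp [ψ, joinSubgroup]
  have hsub : ∀ A B, ψ (A ∪ B) ≤ ψ A + ψ B := by
    intro A B
    simp only [ψ]
    rw [← Real.log_mul (by exact_mod_cast hrel A) (by exact_mod_cast hrel B)]
    refine Real.log_le_log (by exact_mod_cast Nat.pos_of_ne_zero (hrel _)) ?_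
    rw [joinSubgroup_union]
    exact_mod_cast AddSubgroup.relIndex_inf_le
  have hM : ∀ s, ψ {s} ≤ Real.log H.index := by
    intro s
    refine Real.log_le_log (by exact_mod_cast Nat.pos_of_ne_zero (hrel _)) ?_
    have h1 := relIndex_le_index (hH {s}) W
    have h2 : (joinSubgroup γ H {s}).index ≤ H.index := by
      rw [joinSubgroup_singleton]
      exact (AddSubgroup.index_comap H _).trans_le (relIndex_le_index hH0 _)
    exact_mod_cast h1.trans h2
  have htile : ∀ p ∈ D, ψ (tile p) ≤ Real.log ((joinSubgroup γ H p.1).relIndex L) := by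
    intro p hp
    refine Real.log_le_log (by exact_mod_cast Nat.pos_of_ne_zero (hrel _)) ?_
    -- This is where the centre of the tile must lie in F: γ(c) then maps W into N + L, which N ≤
    -- H_T puts inside H_T + L.
    have h1 : W.map (γ p.2) ≤ joinSubgroup γ H p.1 ⊔ L := by
      rintro _ ⟨x, hx, rfl⟩
      exact sup_le_sup_right (hN p hp) L (mem_joinSubgroup.1 hx p.2 (hq.center_mem p hp))
    have h2 : (joinSubgroup γ H (tile p)).relIndex W ≤ (joinSubgroup γ H p.1).relIndex L := by
      rw [joinSubgroup_tile]
      refine (AddSubgroup.relIndex_comap _ _ W).trans_le ((AddSubgroup.relIndex_le_of_le_right h1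
        (relIndex_ne_zero_of_index_ne_zero (hH p.1) _)).trans ?_)
      rw [AddSubgroup.relIndex_sup_left]
    exact_mod_cast h2
  have h1 : Real.log (joinSubgroup γ H F).index ≤ Real.log W.index + ψ F := by
    rw [← Real.log_mul (by exact_mod_cast hNF) (by exact_mod_cast hrel F)]
    refine Real.log_le_log (by exact_mod_cast Nat.pos_of_ne_zero (hH F)) ?_
    have h2 := AddSubgroup.relIndex_mul_index
      (inf_le_right : joinSubgroup γ H F ⊓ W ≤ W)
    rw [AddSubgroup.inf_relIndex_right] at h2
    have h3 := index_le_of_le (AddSubgroup.index_inf_ne_zero (hH F) hNF)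
      (inf_le_left : joinSubgroup γ H F ⊓ W ≤ _)
    rw [← h2, mul_comm] at h3
    exact_mod_cast h3
  have h2 := hsub (tileUnion D) (F \ tileUnion D)
  rw [Finset.union_sdiff_of_subset hq.tileUnion_subset] at h2
  have h3 := tileUnion_le_sum hempty hsub
    (g := fun T => Real.log ((joinSubgroup γ H T).relIndex L)) htile
  have h4 := le_mul_card_of_subadditive hempty hsub hM (F \ tileUnion D)
  linarith

end Index

/-! ### The upper bound for profinite groups -/

section Profinite

variable {S K : Type*} [Semigroup S] [AddCommGroup K] [TopologicalSpace K]
  {γ : S →ₙ* AddMonoid.End K} {L : AddSubgroup K}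

theorem continuous_restrictAction (hL : Invariant γ L) (hγ : ∀ s, Continuous (γ s)) (s : S) :
    Continuous (restrictAction γ L hL s) :=
  ((hγ s).comp continuous_subtype_val).subtype_mk _

theorem continuous_quotientAction (hL : Invariant γ L) (hγ : ∀ s, Continuous (γ s)) (s : S) :
    Continuous (quotientAction γ L hL s) :=
  continuous_quot_lift _ (QuotientAddGroup.continuous_mk.comp (hγ s))

variable [IsTopologicalAddGroup K]

theorem isOpen_sup_of_isOpen {H : AddSubgroup K} (hH : IsOpen (H : Set K)) (L : AddSubgroup K) :
    IsOpen ((H ⊔ L : AddSubgroup K) : Set K) :=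
  AddSubgroup.isOpen_mono le_sup_left hH

variable [CompactSpace K]

/-- The only point where total disconnectedness enters. -/
theorem exists_openAddSubgroup_subset [TotallyDisconnectedSpace K] {N : Set K}
    (hN : N ∈ 𝓝 (0 : K)) : ∃ H : OpenAddSubgroup K, (H : Set K) ⊆ N := by
  obtain ⟨U, hUN, hU, h0⟩ := mem_nhds_iff.1 hN
  obtain ⟨H, hH⟩ := ProfiniteGrp.exist_openNormalAddSubgroup_sub_open_nhds_of_zero hU h0
  exact ⟨H.toOpenAddSubgroup, hH.trans hUN⟩

/-- The part of `H` in the entropy of `γ` is at most its part in the entropy of `γ_L` plus the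
entropy of `γ_{K/L}`. -/
theorem exists_limit_le [IsCancelMul S] (hγ : ∀ s, Continuous (γ s)) [(leftFolner S).NeBot]
    {H : AddSubgroup K} (hH : IsOpen (H : Set K)) {a b : ℝ}
    {c : OpenAddSubgroup K → ℝ}
    (ha : Tendsto (fun F => Real.log (joinSubgroup γ H F).index / F.card) (leftFolner S) (𝓝 a))
    (hb : Tendsto (fun F => Real.log ((joinSubgroup γ H F).relIndex L) / F.card) (leftFolner S)
      (𝓝 b))
    (hc : ∀ N : OpenAddSubgroup K, Tendsto (fun F =>
      Real.log (joinSubgroup γ (N.toAddSubgroup ⊔ L) F).index / F.card) (leftFolner S) (𝓝 (c N)))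
    {ε : ℝ} (hε0 : 0 < ε) (hε : ε ≤ 1 / 2) :
    ∃ N, a ≤ c N + ((b + ε) / (1 - ε) + Real.log H.index * ε) := by
  classical
  have hb0 : 0 ≤ b := ge_of_tendsto' hb fun F =>
    div_nonneg (Real.log_natCast_nonneg _) (by positivity)
  have hidx : ∀ F : Finset S, (joinSubgroup γ H F).index ≠ 0 := fun F =>
    index_ne_zero_of_isOpen (isOpen_joinSubgroup hγ hH F)
  obtain ⟨𝒯, h𝒯, hev⟩ := exists_quasiTiling hε0 hε
    (hb.eventually (Iio_mem_nhds (by linarith : b < b + ε))).frequently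
  -- N depends on the finitely many shapes but not on F, so the limit over F can be taken with N
  -- fixed.
  let N : OpenAddSubgroup K := ⟨joinSubgroup γ H (𝒯.biUnion id), isOpen_joinSubgroup hγ hH _⟩
  refine ⟨N, le_of_tendsto_of_tendsto ha ((hc N).add_const _) ?_⟩
  filter_upwards [hev, eventually_almostInvariant one_pos ∅] with F hF hFne
  obtain ⟨D, hq, hD, hcard⟩ := hF
  have hFpos : (0 : ℝ) < F.card := by exact_mod_cast hFne.1.card_pos
  have h1 := log_index_joinSubgroup_le (L := L) (N := N.toAddSubgroup) hidx
    (index_ne_zero_of_isOpen hH) hq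
    (fun p hp => joinSubgroup_anti H (Finset.subset_biUnion_of_mem id (hD p hp)))
    (index_ne_zero_of_isOpen (isOpen_joinSubgroup hγ (isOpen_sup_of_isOpen N.isOpen L) F))
  have h2 : ∑ p ∈ D, Real.log ((joinSubgroup γ H p.1).relIndex L) ≤
      (b + ε) / (1 - ε) * F.card := by
    refine hq.sum_le_of_ratio_le (f := fun T => Real.log ((joinSubgroup γ H T).relIndex L))
      (by linarith) (by linarith) fun p hp => ?_
    obtain ⟨h3, h4⟩ := h𝒯 _ (hD p hp)
    rw [div_lt_iff₀ (by exact_mod_cast h4.card_pos)] at h3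
    exact h3.le
  have h3 := mul_le_mul_of_nonneg_left hcard (Real.log_natCast_nonneg H.index)
  have h4 : Real.log (joinSubgroup γ H F).index / F.card ≤
      (Real.log (joinSubgroup γ (N.toAddSubgroup ⊔ L) F).index + ((b + ε) / (1 - ε) +
        Real.log H.index * ε) * F.card) / F.card :=
    div_le_div_of_nonneg_right (by linarith) hFpos.le
  rwa [add_div, mul_div_cancel_right₀ _ hFpos.ne'] at h4

end Profinite

end SemigroupEntropy

/-! ### The addition theorem -/

open SemigroupEntropy in
theorem mainTheorem3 {S K : Type*} [Semigroup S] [IsCancelMul S]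
    (hS : SemigroupEntropy.LeftAmenable S)
    [AddCommGroup K] [TopologicalSpace K] [IsTopologicalAddGroup K] [CompactSpace K]
    [TotallyDisconnectedSpace K]
    (γ : S →ₙ* AddMonoid.End K) (hγ : ∀ s : S, Continuous (γ s))
    (L : AddSubgroup K) (hLc : IsClosed (L : Set K)) (hL : SemigroupEntropy.Invariant γ L) :
    SemigroupEntropy.TopEntropyWellDefined (fun s => γ s) ∧
    SemigroupEntropy.TopEntropyWellDefined
      (fun s => SemigroupEntropy.restrictAction γ L hL s) ∧
    SemigroupEntropy.TopEntropyWellDefined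
      (fun s => SemigroupEntropy.quotientAction γ L hL s) ∧
    SemigroupEntropy.topEntropy (fun s => γ s) =
      SemigroupEntropy.topEntropy (fun s => SemigroupEntropy.restrictAction γ L hL s) +
        SemigroupEntropy.topEntropy (fun s => SemigroupEntropy.quotientAction γ L hL s) := by
  have : CompactSpace L := isCompact_iff_compactSpace.1 hLc.isCompact
  have hγL := continuous_restrictAction hL hγ
  have hγQ := continuous_quotientAction hL hγ
  have hwd : TopEntropyWellDefined fun s => γ s :=
    topEntropyWellDefined hS hγ fun s t x => DFunLike.congr_fun (map_mul γ s t) x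
  have hwdL : TopEntropyWellDefined fun s => restrictAction γ L hL s :=
    topEntropyWellDefined hS hγL fun s t x =>
      DFunLike.congr_fun (map_mul (restrictAction γ L hL) s t) x
  have hwdQ : TopEntropyWellDefined fun s => quotientAction γ L hL s :=
    topEntropyWellDefined hS hγQ fun s t x =>
      DFunLike.congr_fun (map_mul (quotientAction γ L hL) s t) x
  refine ⟨hwd, hwdL, hwdQ, ?_⟩
  have hne := hwd.1
  have hopenL : ∀ H : OpenAddSubgroup K, IsOpen (H.toAddSubgroup.addSubgroupOf L : Set L) :=
    fun H => H.isOpen.preimage continuous_subtype_val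
  have hopenQ : ∀ H : OpenAddSubgroup K,
      IsOpen (H.toAddSubgroup.map (QuotientAddGroup.mk' L) : Set (K ⧸ L)) :=
    fun H => QuotientAddGroup.isOpenMap_coe _ H.isOpen
  -- All three suprema are indexed by the open subgroups of K, whose traces on L and images in K/L
  -- form neighbourhood bases of 0.
  let a : OpenAddSubgroup K → ℝ := fun H => coverEntropy (fun s => γ s) (cosetCover H.toAddSubgroup)
  let b : OpenAddSubgroup K → ℝ := fun H =>
    coverEntropy (fun s => restrictAction γ L hL s) (cosetCover (H.toAddSubgroup.addSubgroupOf L))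
  let c : OpenAddSubgroup K → ℝ := fun H =>
    coverEntropy (fun s => quotientAction γ L hL s)
      (cosetCover (H.toAddSubgroup.map (QuotientAddGroup.mk' L)))
  have ha : ∀ H : OpenAddSubgroup K, Tendsto
      (fun F => Real.log (joinSubgroup γ H.toAddSubgroup F).index / F.card)
      (leftFolner S) (𝓝 (a H)) := fun H => hwd.tendsto_log_index hγ H.isOpen
  have hb : ∀ H : OpenAddSubgroup K, Tendsto
      (fun F => Real.log ((joinSubgroup γ H.toAddSubgroup F).relIndex L) / F.card)
      (leftFolner S) (𝓝 (b H)) := fun H =>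
    (hwdL.tendsto_log_index hγL (hopenL H)).congr fun F => by
      rw [joinSubgroup_restrictAction, AddSubgroup.relIndex]
  have hc : ∀ H : OpenAddSubgroup K, Tendsto
      (fun F => Real.log (joinSubgroup γ (H.toAddSubgroup ⊔ L) F).index / F.card)
      (leftFolner S) (𝓝 (c H)) := fun H =>
    (hwdQ.tendsto_log_index hγQ (hopenQ H)).congr fun F => by
      rw [index_joinSubgroup_quotientAction]
  rw [topEntropy_eq_iSup_cosetCover hwd hγ (J := fun H : OpenAddSubgroup K => H.toAddSubgroup)
      (fun H => H.isOpen) (fun N hN => exists_openAddSubgroup_subset hN),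
    topEntropy_eq_iSup_cosetCover hwdL hγL hopenL (fun N hN => ?_),
    topEntropy_eq_iSup_cosetCover hwdQ hγQ hopenQ (fun N hN => ?_)]
  · change ⨆ H, ENNReal.ofReal (a H) =
      (⨆ H, ENNReal.ofReal (b H)) + ⨆ H, ENNReal.ofReal (c H)
    have hb0 : ∀ H, 0 ≤ b H := fun H => ge_of_tendsto' (hb H) fun F =>
      div_nonneg (Real.log_natCast_nonneg _) (by positivity)
    have hc0 : ∀ H, 0 ≤ c H := fun H => ge_of_tendsto' (hc H) fun F =>
      div_nonneg (Real.log_natCast_nonneg _) (by positivity)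
    apply le_antisymm
    · refine iSup_le fun H => ?_
      by_cases htop : (⨆ H, ENNReal.ofReal (c H)) = ⊤
      · rw [htop, add_top]
        exact le_top
      have hcle : ∀ N, c N ≤ (⨆ H, ENNReal.ofReal (c H)).toReal := fun N =>
        (ENNReal.ofReal_le_iff_le_toReal htop).1 (le_iSup (fun H => ENNReal.ofReal (c H)) N)
      -- The subgroup N of `exists_limit_le` varies with ε, so c(N) is replaced by the finite
      -- supremum before ε tends to 0.
      have h1 : a H - (⨆ H, ENNReal.ofReal (c H)).toReal ≤ b H := by
        refine le_of_forall_le_div_add (M := Real.log H.toAddSubgroup.index) fun ε hε0 hε => ?_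
        obtain ⟨N, hN⟩ := exists_limit_le hγ H.isOpen (ha H) (hb H) hc hε0 hε
        have := hcle N
        linarith
      calc ENNReal.ofReal (a H)
          ≤ ENNReal.ofReal (b H + (⨆ H, ENNReal.ofReal (c H)).toReal) :=
            ENNReal.ofReal_le_ofReal (by linarith)
        _ = ENNReal.ofReal (b H) + ⨆ H, ENNReal.ofReal (c H) := by
            rw [ENNReal.ofReal_add (hb0 H) ENNReal.toReal_nonneg, ENNReal.ofReal_toReal htop]
        _ ≤ _ := add_le_add_left (le_iSup (fun H => ENNReal.ofReal (b H)) H) _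
    · have hbmono : ∀ {H H' : OpenAddSubgroup K}, H ≤ H' → b H' ≤ b H := fun {H H'} h =>
        le_of_tendsto_of_tendsto' (hb H') (hb H) fun F => by
          have h1 := index_ne_zero_of_isOpen (isOpen_joinSubgroup hγ H.isOpen F)
          have h2 := index_ne_zero_of_isOpen (isOpen_joinSubgroup hγ H'.isOpen F)
          refine div_le_div_of_nonneg_right (Real.log_le_log ?_ ?_) (by positivity)
          · exact_mod_cast Nat.pos_of_ne_zero (relIndex_ne_zero_of_index_ne_zero h2 L)
          · exact_mod_cast AddSubgroup.relIndex_le_of_le_left (joinSubgroup_mono h F)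
              (relIndex_ne_zero_of_index_ne_zero h1 L)
      have hcmono : ∀ {H H' : OpenAddSubgroup K}, H ≤ H' → c H' ≤ c H := fun {H H'} h =>
        le_of_tendsto_of_tendsto' (hc H') (hc H) fun F => by
          have h1 := index_ne_zero_of_isOpen
            (isOpen_joinSubgroup hγ (isOpen_sup_of_isOpen H.isOpen L) F)
          have h2 := index_ne_zero_of_isOpen
            (isOpen_joinSubgroup hγ (isOpen_sup_of_isOpen H'.isOpen L) F)
          refine div_le_div_of_nonneg_right (Real.log_le_log ?_ ?_) (by positivity)
          · exact_mod_cast Nat.pos_of_ne_zero h2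
          · exact_mod_cast index_le_of_le h1
              (joinSubgroup_mono (sup_le_sup_right (show H.toAddSubgroup ≤ H'.toAddSubgroup from h)
                L) F)
      -- Both families increase as the subgroup shrinks, so H ⊓ H' dominates b at H and c at H'
      -- simultaneously.
      rw [ENNReal.iSup_add_iSup fun H H' => ⟨H ⊓ H', add_le_add
        (ENNReal.ofReal_le_ofReal (hbmono inf_le_left))
        (ENNReal.ofReal_le_ofReal (hcmono inf_le_right))⟩]
      refine iSup_mono fun H => ?_
      rw [← ENNReal.ofReal_add (hb0 H) (hc0 H)]
      refine ENNReal.ofReal_le_ofReal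
        (le_of_tendsto_of_tendsto' ((hb H).add (hc H)) (ha H) fun F => ?_)
      rw [← add_div]
      exact div_le_div_of_nonneg_right (log_relIndex_add_log_index_le hL
        (index_ne_zero_of_isOpen (isOpen_joinSubgroup hγ H.isOpen F))) (by positivity)
  · obtain ⟨H, hH⟩ := exists_openAddSubgroup_subset
      (ContinuousAt.preimage_mem_nhds (x := (0 : K))
        (QuotientAddGroup.continuous_mk (N := L)).continuousAt hN)
    refine ⟨H, ?_⟩
    rintro _ ⟨x, hx, rfl⟩
    exact hH hx
  · rw [nhds_subtype, mem_comap] at hN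
    obtain ⟨N', hN', hsub⟩ := hN
    obtain ⟨H, hH⟩ := exists_openAddSubgroup_subset hN'
    exact ⟨H, fun x hx => hsub (hH hx)⟩
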